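/- **Setting.** Let $\Sigma$ be a compact connected surface (of any genus, orientable or not, possibly with boundary), and let a finite graph with at least one edge be embedded in $\Sigma$ so that $\partial\Sigma$ is a union of edges and the complementary faces are open discs bounded by closed walks of edges (polygons). Put a qubit on every edge. For a vertex $s$ and a face $p$ let $$A_s=\prod_{i\in\mathrm{legs}(s)}\sigma^x_i,\qquad B_p=\prod_{i\in\mathrm{boundary}(p)}\sigma^z_i ,$$ where the products run over the ends of edges at $s$, respectively over the sides of edges along $p$ (so an edge occurs twice if both its ends are at $s$, or both its sides are in $p$). The toric code Hamiltonian is $H=-U\sum_sA_s-J\sum_pB_p$ with $U,J>0$, and a ground state is a unit vector $|\psi\rangle$ that is an eigenvector of $H$ for its least eigenvalue. **Regions.** A region is a set $A$ of edges, and $B$ is the complementary set; both are assumed nonempty, and no edge of $A$ lies on $\partial\Sigma$. The tile of an edge $e\not\subset\partial\Sigma$ is the closed quadrilateral with vertices the two ends of $e$ and the centres of the two faces at $e$, and $A$ is identified with the union of the tiles of its edges, a two-dimensional complex. The region $A$ is *contractible* if it is connected, in the sense that any two edges of $A$ are linked by a chain of edges of $A$ of which consecutive ones lie on a common face, and if it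 is simply connected, i.e. every closed edge walk in this complex is null-homotopic in it. Let $n_{AB}$ be the number of faces (plaquettes) whose boundary contains both an edge of $A$ and an edge of $B$. **Statement.** If $A$ is contractible, then for every ground state $|\psi\rangle$ the logarithmic negativity $E^{A|B}_{\mathcal N}(\rho)=\log_2\operatorname{tr}\bigl|\rho^{T_A}\bigr|$, where $\rho^{T_A}$ is the partial transpose over the qubits in $A$ and $|O|=\sqrt{O^\dagger O}$, satisfies $$E^{A|B}_{\mathcal N}\bigl(|\psi\rangle\langle\psi|\bigr)=n_{AB}-1 .$$ Also the Rényi entropy of index $1/2$ of the reduced state $\rho_A=\operatorname{tr}_B|\psi\rangle\langle\psi|$ is $$S_{1/2}(\rho_A)=2\log_2\operatorname{tr}\rho_A^{1/2}=n_{AB}-1 .$$ -/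

import Mathlib

open scoped MatrixOrder ComplexOrder

/-! ## Lattices on surfaces -/

/-- A lattice on a surface: a finite graph embedded in a compact connected surface (of any genus,
orientable or not, with or without boundary) so that the complementary faces are polygonal discs,
encoded by its finite set `Φ` of flags.  A flag is a triangle of the barycentric subdivision, that
is, an incident triple (vertex, edge, face), together with the side of the edge and the half of the
edge on which it lies.  `vertexFlip`, `edgeFlip`, `faceFlip` send a flag to the neighbouring
flag which differs from it (only) in the position of the vertex, of the edge, of the face.
A flag fixed by `faceFlip` is one whose edge lies on the boundary of the surface. -/
structure SurfaceLattice (Φ : Type*) where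
  nonempty : Nonempty Φ
  vertexFlip : Φ → Φ
  edgeFlip : Φ → Φ
  faceFlip : Φ → Φ
  vertexFlip_invol : Function.Involutive vertexFlip
  edgeFlip_invol : Function.Involutive edgeFlip
  faceFlip_invol : Function.Involutive faceFlip
  vertexFlip_ne : ∀ x, vertexFlip x ≠ x
  edgeFlip_ne : ∀ x, edgeFlip x ≠ x
  /-- the flags of an edge form a quadrilateral, or a pair for an edge on the boundary -/
  flip_comm : ∀ x, vertexFlip (faceFlip x) = faceFlip (vertexFlip x)
  faceFlip_ne_vertexFlip : ∀ x, faceFlip x ≠ vertexFlip x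
  /-- the surface is connected -/
  connected : ∀ x y, Relation.ReflTransGen
    (fun a b => b = vertexFlip a ∨ b = edgeFlip a ∨ b = faceFlip a) x y

namespace SurfaceLattice

variable {Φ : Type*} (L : SurfaceLattice Φ)

/-- Vertices of the lattice. -/
def Vertex : Type _ := Quot (fun x y : Φ => y = L.edgeFlip x ∨ y = L.faceFlip x)

/-- Edges of the lattice; each carries one qubit. -/
def Edge : Type _ := Quot (fun x y : Φ => y = L.vertexFlip x ∨ y = L.faceFlip x)

/-- Faces of the lattice. -/
def Face : Type _ := Quot (fun x y : Φ => y = L.vertexFlip x ∨ y = L.edgeFlip x)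

/-- Legs: ends of edges.  Every edge has two of them. -/
def Leg : Type _ := Quot (fun x y : Φ => y = L.faceFlip x)

/-- Sides of edges.  An edge has two of them, or one if it lies on the boundary of the surface. -/
def Side : Type _ := Quot (fun x y : Φ => y = L.vertexFlip x)

/-- Corners of faces; each joins a vertex of the lattice to (the centre of) a face. -/
def Corner : Type _ := Quot (fun x y : Φ => y = L.edgeFlip x)

/-- The vertex of a flag. -/
def vertex (x : Φ) : L.Vertex := Quot.mk _ x

/-- The edge of a flag. -/
def edge (x : Φ) : L.Edge := Quot.mk _ x

/-- The face of a flag. -/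
def face (x : Φ) : L.Face := Quot.mk _ x

/-- The corner of a flag. -/
def corner (x : Φ) : L.Corner := Quot.mk _ x

variable {L}

/-- The vertex to which a leg is attached. -/
def Leg.vertex : L.Leg → L.Vertex :=
  Quot.lift L.vertex (fun _ _ h => Quot.sound (Or.inr h))

/-- The edge of which a leg is an end. -/
def Leg.edge : L.Leg → L.Edge :=
  Quot.lift L.edge (fun _ _ h => Quot.sound (Or.inr h))

/-- The edge of a side. -/
def Side.edge : L.Side → L.Edge :=
  Quot.lift L.edge (fun _ _ h => Quot.sound (Or.inl h))

/-- The face which lies on a side of an edge. -/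
def Side.face : L.Side → L.Face :=
  Quot.lift L.face (fun _ _ h => Quot.sound (Or.inl h))

/-- The vertex of a corner. -/
def Corner.vertex : L.Corner → L.Vertex :=
  Quot.lift L.vertex (fun _ _ h => Quot.sound (Or.inl h))

/-- The face of a corner. -/
def Corner.face : L.Corner → L.Face :=
  Quot.lift L.face (fun _ _ h => Quot.sound (Or.inr h))

variable (L)

instance [Finite Φ] : Finite L.Vertex := inferInstanceAs (Finite (Quot _))
instance [Finite Φ] : Finite L.Edge := inferInstanceAs (Finite (Quot _))
instance [Finite Φ] : Finite L.Face := inferInstanceAs (Finite (Quot _))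
noncomputable instance [Finite Φ] : Fintype L.Vertex := Fintype.ofFinite _
noncomputable instance [Finite Φ] : Fintype L.Edge := Fintype.ofFinite _
noncomputable instance [Finite Φ] : Fintype L.Face := Fintype.ofFinite _
noncomputable instance : DecidableEq L.Edge := Classical.decEq _

/-! ## Contractible regions

A region is a set `A` of qubits, that is, of edges.  To an edge `e` off the boundary of the surface
belongs the quadrilateral tile of its four flags, whose corners are the two ends of `e` and the
centres of the two faces at `e`, and whose four boundary arcs are corners of faces.  These tiles
cover the surface (up to the half tiles of boundary edges), and `A` is identified with the union of
its closed tiles.  It is a complex with 0-cells the vertices and faces, 1-cells the corners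
and 2-cells the edges which belong to `A`. -/

/-- The 0-cells of the complex of tiles: vertices and (centres of) faces of the lattice. -/
abbrev Node := L.Vertex ⊕ L.Face

/-- A traversal of a corner: from the vertex to the face for `true`, and backwards for `false`. -/
abbrev Step := L.Corner × Bool

variable {L}

/-- The node at which a step starts. -/
def Step.source : L.Step → L.Node
  | (c, true) => Sum.inl c.vertex
  | (c, false) => Sum.inr c.face

/-- The node at which a step ends. -/
def Step.target : L.Step → L.Node
  | (c, true) => Sum.inr c.face
  | (c, false) => Sum.inl c.vertex

/-- `IsWalk A m w n`: the list of steps `w` is a walk from `m` to `n` along sides of tiles of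
edges in `A`. -/
def IsWalk (A : Set L.Edge) : L.Node → List L.Step → L.Node → Prop
  | m, [], n => m = n
  | m, s :: w, n =>
      (∃ x, L.edge x ∈ A ∧ L.corner x = s.1) ∧ Step.source s = m ∧ IsWalk A (Step.target s) w n

/-- The elementary deformations of walks in the region `A`: to insert a step followed by its
reverse, or to replace a walk from one end of an edge in `A` to the other along one side of the edge
by the walk along the other side, that is, to push the walk across the tile of that edge. -/
inductive Deform (A : Set L.Edge) : List L.Step → List L.Step → Prop
  | backtrack (u v : List L.Step) (c : L.Corner) (b : Bool) :
      Deform A (u ++ v) (u ++ [(c, b), (c, !b)] ++ v)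
  | tile (u v : List L.Step) (x : Φ) (hx : L.edge x ∈ A) :
      Deform A
        (u ++ [(L.corner x, true), (L.corner (L.vertexFlip x), false)] ++ v)
        (u ++ [(L.corner (L.faceFlip x), true),
          (L.corner (L.vertexFlip (L.faceFlip x)), false)] ++ v)

/-- Homotopy, inside the region `A`, of walks from `m` to `n` in `A`. -/
def Homotopic (A : Set L.Edge) (m n : L.Node) : List L.Step → List L.Step → Prop :=
  Relation.EqvGen (fun w w' => IsWalk A m w n ∧ IsWalk A m w' n ∧ Deform A w w')

/-- A contractible region: it is connected (its qubits are linked by chains of its qubits of which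
consecutive ones share a plaquette) and every closed walk in it is null-homotopic in it. -/
structure IsContractible (A : Set L.Edge) : Prop where
  connected : ∀ e ∈ A, ∀ e' ∈ A, Relation.ReflTransGen
    (fun a b => b ∈ A ∧ ∃ x y, L.edge x = a ∧ L.edge y = b ∧ L.face x = L.face y) e e'
  simplyConnected : ∀ (n : L.Node) (w : List L.Step), IsWalk A n w n → Homotopic A n n w []

/-- The number of plaquettes which straddle the boundary between the region `A` and its
complement: those with edges in both. -/
noncomputable def numStraddling (A : Set L.Edge) : ℕ :=
  Nat.card {p : L.Face // (∃ x, L.face x = p ∧ L.edge x ∈ A) ∧ ∃ y, L.face y = p ∧ L.edge y ∉ A}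

/-! ## The toric code -/

variable (L)

/-- The number of legs at the vertex `v` which belong to the edge `e` (two for a loop). -/
noncomputable def legs (v : L.Vertex) (e : L.Edge) : ℕ :=
  Nat.card {h : L.Leg // h.vertex = v ∧ h.edge = e}

/-- The number of times that the edge `e` occurs in the boundary of the face `p`. -/
noncomputable def sides (p : L.Face) (e : L.Edge) : ℕ :=
  Nat.card {h : L.Side // h.face = p ∧ h.edge = e}

end SurfaceLattice

/-- The Pauli matrix `σˣ`. -/
def pauliX : Matrix (Fin 2) (Fin 2) ℂ := !![0, 1; 1, 0]

/-- The Pauli matrix `σᶻ`. -/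
def pauliZ : Matrix (Fin 2) (Fin 2) ℂ := !![1, 0; 0, -1]

/-- The operator `⨂ e, M e` on `(ℂ²)^{⊗ E}`, in the product basis indexed by `E → Fin 2`. -/
def tensorOp {E : Type*} [Fintype E] (M : E → Matrix (Fin 2) (Fin 2) ℂ) :
    Matrix (E → Fin 2) (E → Fin 2) ℂ :=
  Matrix.of fun s t => ∏ e, M e (s e) (t e)

namespace SurfaceLattice

variable {Φ : Type*} [Finite Φ] (L : SurfaceLattice Φ)

/-- The star operator of a vertex: the product of `σˣ` over its legs. -/
noncomputable def starOp (v : L.Vertex) : Matrix (L.Edge → Fin 2) (L.Edge → Fin 2) ℂ :=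
  tensorOp fun e => pauliX ^ L.legs v e

/-- The plaquette operator of a face: the product of `σᶻ` over its boundary. -/
noncomputable def plaquetteOp (p : L.Face) : Matrix (L.Edge → Fin 2) (L.Edge → Fin 2) ℂ :=
  tensorOp fun e => pauliZ ^ L.sides p e

/-- The toric code Hamiltonian `-U ∑ A_s - J ∑ B_p`. -/
noncomputable def hamiltonian (U J : ℝ) : Matrix (L.Edge → Fin 2) (L.Edge → Fin 2) ℂ :=
  -((U : ℂ) • (∑ v, L.starOp v)) - (J : ℂ) • (∑ p, L.plaquetteOp p)

end SurfaceLattice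

/-- A ground state of `H`: a normalized eigenvector of `H` for its least (real) eigenvalue. -/
def IsGroundState {n : Type*} [Fintype n] (H : Matrix n n ℂ) (ψ : n → ℂ) : Prop :=
  ∑ s, ‖ψ s‖ ^ 2 = 1 ∧ ∃ E₀ : ℝ, Matrix.mulVec H ψ = (E₀ : ℂ) • ψ ∧
    IsLeast {E : ℝ | ∃ φ : n → ℂ, φ ≠ 0 ∧ Matrix.mulVec H φ = (E : ℂ) • φ} E₀

/-! ## Negativity and Rényi entropy -/

section Entanglement

variable {E : Type*} [Fintype E] [DecidableEq E]

/-- The density matrix `|ψ⟩⟨ψ|`. -/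
def pureState {n : Type*} (ψ : n → ℂ) : Matrix n n ℂ :=
  Matrix.of fun s t => ψ s * (starRingEnd ℂ) (ψ t)

open Classical in
/-- The partial transpose of an operator on `(ℂ²)^{⊗ E}` over the qubits in `A`. -/
noncomputable def partialTranspose (A : Set E) (ρ : Matrix (E → Fin 2) (E → Fin 2) ℂ) :
    Matrix (E → Fin 2) (E → Fin 2) ℂ :=
  Matrix.of fun s t =>
    ρ (fun e => if e ∈ A then t e else s e) (fun e => if e ∈ A then s e else t e)

/-- The logarithmic negativity `log₂ tr |ρ^{T_A}|` between `A` and its complement, where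
`|O| = √(O† O)`. -/
noncomputable def logNegativity (A : Set E) (ρ : Matrix (E → Fin 2) (E → Fin 2) ℂ) : ℝ :=
  Real.logb 2 (CFC.abs (partialTranspose A ρ)).trace.re

open Classical in
/-- The reduced operator on the qubits in `A`: the partial trace over the other qubits. -/
noncomputable def reducedState (A : Set E) (ρ : Matrix (E → Fin 2) (E → Fin 2) ℂ) :
    Matrix (A → Fin 2) (A → Fin 2) ℂ :=
  Matrix.of fun s t => ∑ r : {e // e ∉ A} → Fin 2,
    ρ (fun e => if h : e ∈ A then s ⟨e, h⟩ else r ⟨e, h⟩)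
      (fun e => if h : e ∈ A then t ⟨e, h⟩ else r ⟨e, h⟩)

open Classical in
/-- The Rényi entropy of index `1/2`, in bits, `2 log₂ tr ρ^{1/2}`. -/
noncomputable def renyiHalf {n : Type*} [Finite n] (ρ : Matrix n n ℂ) : ℝ :=
  letI : Fintype n := Fintype.ofFinite n
  2 * Real.logb 2 (CFC.sqrt ρ).trace.re

end Entanglement

/-!
Configurations of the qubits are vectors over `ZMod 2` indexed by the edges. A ground state is a
function `ψ` of them which is invariant under translation by the stars of the vertices and is
supported on the configurations that meet every face evenly (`IsStabilized.of_isGroundState`): the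
uniform superposition of products of stars has both properties, so every star and plaquette term of
the Hamiltonian attains its minimum in a ground state.

Contractibility of `A` enters through two dual statements modulo two. A configuration which meets
all faces inside `A` evenly agrees on `A` with a sum of stars (`IsContractible.exists_eq_starSum`),
and a configuration supported on `A` which meets all faces evenly is itself a sum of stars
(`IsContractible.mem_range_starSum`). Both rest on the vanishing of the first cohomology of the
complex of tiles (`IsCocycle.exists_potential`), where the holonomy of a cocycle along a closed walk
is zero by homotopy invariance. The cocycles are solutions of linear systems around the faces or
around the vertices, obtained from the Fredholm alternative (`exists_orbit_potential`).

Let `M` be the matrix of amplitudes of `ψ`, with rows for the configurations on `A`. An entry of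
`M Mᴴ M` sums over exchanges of the parts on `A` of two configurations; a nonzero term requires these
parts to differ by a cycle of `A`, hence by a sum of stars, which does not change the amplitudes.
Therefore `M Mᴴ M = l • M` (`IsStabilized.sum_exchange`), where `l` is the probability that the
configuration on `A` lies in a given coset of the cycles of `A`. This probability is the same for
all cosets of cycles in the space of inner cycles (configurations on `A` which meet evenly all faces
but the straddling ones), and zero for the others, so `l` is the ratio of the numbers of cycles and
of inner cycles. The parities of inner cycles at the straddling faces form the vectors with even
sum, whence `l = 2 / 2 ^ numStraddling A` (`IsContractible.finrank_innerCycles`).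

Finally `M Mᴴ M = l • M` makes the reduced state satisfy `ρ ^ 2 = l • ρ` and the partial transpose
satisfy `R ^ 3 = l ^ 2 • R`. So `√ρ` and `|R|` are explicit multiples of `ρ` and `R ^ 2`, with traces
`√l⁻¹` and `l⁻¹` (`entanglement_of_flat_spectrum`).
-/

/-! ### Sums over the orbits of an involution -/

theorem Quot.mk_eq_mk_iff_of_involutive {α : Type*} {σ : α → α} (hσ : Function.Involutive σ)
    (x y : α) :
    Quot.mk (fun a b => b = σ a) x = Quot.mk (fun a b => b = σ a) y ↔ y = x ∨ y = σ x := by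
  constructor
  · intro h
    let F : Quot (fun a b => b = σ a) → Set α :=
      Quot.lift (fun a => ({a, σ a} : Set α)) (by
        rintro a _ rfl
        rw [hσ a]
        exact Set.pair_comm _ _)
    have hF : F (Quot.mk _ x) = F (Quot.mk _ y) := congrArg F h
    have hy : y ∈ F (Quot.mk _ y) := Set.mem_insert _ _
    rw [← hF] at hy
    exact hy
  · rintro (rfl | rfl)
    · rfl
    · exact Quot.sound rfl

open scoped Classical in
theorem sum_fiber_quot_of_involutive {α M : Type*} [Fintype α] [AddCommMonoid M] {σ : α → α}
    (hσ : Function.Involutive σ) {x : α} (hx : σ x ≠ x) (F : α → M) :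
    ∑ y with Quot.mk (fun a b => b = σ a) y = Quot.mk (fun a b => b = σ a) x, F y
      = F x + F (σ x) := by
  rw [← Finset.sum_pair hx.symm]
  refine Finset.sum_congr ?_ fun _ _ => rfl
  ext y
  simp only [Finset.mem_filter, Finset.mem_univ, true_and, Finset.mem_insert,
    Finset.mem_singleton]
  rw [eq_comm, Quot.mk_eq_mk_iff_of_involutive hσ]

/-- The sum of an invariant function over a set on which a free involution acts vanishes in
characteristic two. -/
theorem sum_eq_zero_of_involutive {α : Type*} [Fintype α] {σ : α → α}
    (hσ : Function.Involutive σ) (hfree : ∀ x, σ x ≠ x) (F : α → ZMod 2)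
    (hF : ∀ x, F (σ x) = F x) : ∑ x, F x = 0 :=
  Finset.sum_involution (fun x _ => σ x) (fun x _ => by rw [hF, CharTwo.add_self_eq_zero])
    (fun x _ _ => hfree x) (fun _ _ => Finset.mem_univ _) (fun x _ => hσ x)

/-- A vector which pairs to zero with everything orthogonal to a subspace lies in that subspace. -/
theorem mem_of_forall_dotProduct_eq_zero {ι : Type*} [Fintype ι] {k : Type*} [Field k]
    (W : Submodule k (ι → k)) (y : ι → k)
    (h : ∀ τ : ι → k, (∀ w ∈ W, ∑ i, τ i * w i = 0) → ∑ i, τ i * y i = 0) : y ∈ W := by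
  classical
  by_contra hy
  obtain ⟨f, hfy, hfW⟩ := Submodule.exists_le_ker_of_notMem hy
  have hf : ∀ w, f w = ∑ i, f (Pi.single i 1) * w i := by
    intro w
    conv_lhs => rw [pi_eq_sum_univ' w, map_sum]
    refine Finset.sum_congr rfl fun i _ => ?_
    rw [map_smul, smul_eq_mul, mul_comm]
  apply hfy
  rw [hf]
  refine h _ fun w hw => ?_
  rw [← hf]
  exact hfW hw

/-- Potentials for a pair of involutions `σ`, `ε`: a function `y` of the `σ`-orbits is, on the
`σ`-stable set `D`, the sum of the values of a function `φ` of the `ε`-orbits at the two points of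
each `σ`-orbit, as soon as `y` sums to zero over every union of `σ`-orbits in `D` which is
`ε`-stable.  This is Fredholm's alternative for the linear system satisfied by `φ`. -/
theorem exists_orbit_potential {Φ : Type*} [Finite Φ] {σ ε : Φ → Φ}
    (hσ : Function.Involutive σ) (hε : Function.Involutive ε) (hεfree : ∀ x, ε x ≠ x)
    (D : Set Φ) (hD : ∀ x ∈ D, σ x ∈ D) (hσfree : ∀ x ∈ D, σ x ≠ x)
    [Fintype (Quot (fun a b => b = σ a))]
    (y : Quot (fun a b => b = σ a) → ZMod 2)
    (H : ∀ τ : Quot (fun a b => b = σ a) → ZMod 2, (∀ x, x ∉ D → τ (Quot.mk _ x) = 0) →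
      (∀ x, τ (Quot.mk _ (ε x)) = τ (Quot.mk _ x)) → ∑ q, τ q * y q = 0) :
    ∃ φ : Quot (fun a b => b = ε a) → ZMod 2,
      ∀ x ∈ D, φ (Quot.mk _ x) + φ (Quot.mk _ (σ x)) = y (Quot.mk _ x) := by
  classical
  have := Fintype.ofFinite Φ
  have hD' : ∀ x, σ x ∈ D ↔ x ∈ D := fun x => ⟨fun h => by simpa [hσ x] using hD _ h, hD x⟩
  let χ : Quot (fun a b => b = σ a) → ZMod 2 :=
    Quot.lift (fun x => if x ∈ D then 1 else 0) (by
      rintro a _ rfl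
      simp [hD'])
  have hχ : ∀ x, χ (Quot.mk _ x) = if x ∈ D then 1 else 0 := fun _ => rfl
  let T : (Quot (fun a b => b = ε a) → ZMod 2) →ₗ[ZMod 2]
      (Quot (fun a b => b = σ a) → ZMod 2) :=
    { toFun := fun φ q => ∑ x with Quot.mk (fun a b => b = σ a) x = q,
        χ (Quot.mk _ x) * φ (Quot.mk _ x)
      map_add' := by
        intro φ φ'
        ext q
        simp [mul_add, Finset.sum_add_distrib]
      map_smul' := by
        intro c φ
        ext q
        simp [Finset.mul_sum, mul_left_comm] }
  have hT : ∀ φ q, T φ q = ∑ x with Quot.mk (fun a b => b = σ a) x = q,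
        χ (Quot.mk _ x) * φ (Quot.mk _ x) := fun _ _ => rfl
  -- A functional `τ` orthogonal to the range of `T` is `ε`-invariant on `D`, as is seen by testing
  -- it on the indicators of the `ε`-orbits.
  have key : (fun q => χ q * y q) ∈ LinearMap.range T := by
    refine mem_of_forall_dotProduct_eq_zero _ _ fun τ hτ => ?_
    have := H (fun q => τ q * χ q) (fun x hx => by simp [hχ, hx]) fun x => ?_
    · simpa [mul_assoc] using this
    · have h1 := hτ (T (Pi.single (Quot.mk _ x) 1)) ⟨_, rfl⟩
      have h2 : ∑ q, τ q * T (Pi.single (Quot.mk _ x) 1) q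
          = ∑ z with Quot.mk (fun a b => b = ε a) z = Quot.mk _ x,
              τ (Quot.mk _ z) * χ (Quot.mk _ z) := by
        rw [Finset.sum_filter]
        rw [← Finset.sum_fiberwise Finset.univ (fun z : Φ => Quot.mk (fun a b => b = σ a) z)]
        refine Finset.sum_congr rfl fun q _ => ?_
        rw [hT, Finset.mul_sum]
        refine Finset.sum_congr rfl fun z hz => ?_
        rw [← (Finset.mem_filter.1 hz).2, Pi.single_apply]
        split_ifs <;> simp
      rw [h2, sum_fiber_quot_of_involutive hε (hεfree x)] at h1
      exact (CharTwo.add_eq_zero.1 h1).symm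
  obtain ⟨φ, hφ⟩ := key
  refine ⟨φ, fun x hx => ?_⟩
  have h := congrFun hφ (Quot.mk _ x)
  rw [hT, sum_fiber_quot_of_involutive hσ (hσfree x hx)] at h
  simpa [hχ, hx, hD' x] using h

/-- Summation over a finite type `K` of incidences between `V` and `E`. -/
theorem sum_mul_card_incidence {K V E : Type*} [Fintype K] [Fintype V] [DecidableEq E]
    (α : K → V) (β : K → E) (h : V → ZMod 2) (e : E) :
    ∑ v, h v * (Nat.card {k // α k = v ∧ β k = e} : ZMod 2) = ∑ k with β k = e, h (α k) := by
  classical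
  rw [← Finset.sum_fiberwise _ α]
  refine Finset.sum_congr rfl fun v _ => ?_
  rw [Nat.card_eq_fintype_card, Fintype.card_subtype, Finset.filter_filter]
  have : ∀ k ∈ Finset.univ.filter (fun k => β k = e ∧ α k = v), h (α k) = h v := by
    intro k hk
    rw [(Finset.mem_filter.1 hk).2.2]
  rw [Finset.sum_congr rfl this, Finset.sum_const, nsmul_eq_mul, mul_comm]
  simp only [and_comm]

namespace SurfaceLattice

variable {Φ : Type*} (L : SurfaceLattice Φ)

/-! ### Incidence on the lattice -/

/-- The leg of a flag. -/
def leg (x : Φ) : L.Leg := Quot.mk _ x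

/-- The side of a flag. -/
def side (x : Φ) : L.Side := Quot.mk _ x

instance [Finite Φ] : Finite L.Leg := inferInstanceAs (Finite (Quot _))
instance [Finite Φ] : Finite L.Side := inferInstanceAs (Finite (Quot _))
noncomputable instance [Finite Φ] : Fintype L.Leg := Fintype.ofFinite _
noncomputable instance [Finite Φ] : Fintype L.Side := Fintype.ofFinite _

theorem vertex_edgeFlip (x : Φ) : L.vertex (L.edgeFlip x) = L.vertex x :=
  Eq.symm (by exact Quot.sound (Or.inl rfl))

theorem vertex_faceFlip (x : Φ) : L.vertex (L.faceFlip x) = L.vertex x :=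
  Eq.symm (by exact Quot.sound (Or.inr rfl))

theorem edge_vertexFlip (x : Φ) : L.edge (L.vertexFlip x) = L.edge x :=
  Eq.symm (by exact Quot.sound (Or.inl rfl))

theorem edge_faceFlip (x : Φ) : L.edge (L.faceFlip x) = L.edge x :=
  Eq.symm (by exact Quot.sound (Or.inr rfl))

theorem face_vertexFlip (x : Φ) : L.face (L.vertexFlip x) = L.face x :=
  Eq.symm (by exact Quot.sound (Or.inl rfl))

theorem face_edgeFlip (x : Φ) : L.face (L.edgeFlip x) = L.face x :=
  Eq.symm (by exact Quot.sound (Or.inr rfl))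

theorem edge_surjective (e : L.Edge) : ∃ x, L.edge x = e := Quot.exists_rep e

/-- The flags of an edge form one orbit of the group generated by the commuting involutions
`vertexFlip` and `faceFlip`. -/
theorem edge_eq_edge_iff (x y : Φ) : L.edge x = L.edge y ↔
    y = x ∨ y = L.vertexFlip x ∨ y = L.faceFlip x ∨ y = L.vertexFlip (L.faceFlip x) := by
  constructor
  · intro h
    let F : L.Edge → Set Φ := Quot.lift
      (fun a => ({a, L.vertexFlip a, L.faceFlip a, L.vertexFlip (L.faceFlip a)} : Set Φ)) (by
        rintro a _ (rfl | rfl)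
        · ext z
          simp only [Set.mem_insert_iff, Set.mem_singleton_iff, L.vertexFlip_invol a,
            ← L.flip_comm, L.vertexFlip_invol (L.faceFlip a)]
          tauto
        · ext z
          simp only [Set.mem_insert_iff, Set.mem_singleton_iff, L.faceFlip_invol a]
          tauto)
    have hF : F (L.edge x) = F (L.edge y) := congrArg F h
    have hy : y ∈ F (L.edge y) := Set.mem_insert _ _
    rw [← hF] at hy
    exact hy
  · rintro (rfl | rfl | rfl | rfl)
    · rfl
    · rw [edge_vertexFlip]
    · rw [edge_faceFlip]
    · rw [edge_vertexFlip, edge_faceFlip]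

theorem leg_ne_leg_vertexFlip (x : Φ) : L.leg x ≠ L.leg (L.vertexFlip x) := by
  intro h
  rcases (Quot.mk_eq_mk_iff_of_involutive L.faceFlip_invol _ _).1 h with h | h
  · exact L.vertexFlip_ne x h
  · exact L.faceFlip_ne_vertexFlip x h.symm

theorem side_ne_side_faceFlip (x : Φ) (hx : L.faceFlip x ≠ x) :
    L.side x ≠ L.side (L.faceFlip x) := by
  intro h
  rcases (Quot.mk_eq_mk_iff_of_involutive L.vertexFlip_invol _ _).1 h with h | h
  · exact hx h
  · exact L.faceFlip_ne_vertexFlip x h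

theorem leg_edge_eq_iff (x : Φ) (l : L.Leg) :
    l.edge = L.edge x ↔ l = L.leg x ∨ l = L.leg (L.vertexFlip x) := by
  induction l using Quot.ind with | _ y
  change L.edge y = L.edge x ↔ L.leg y = _ ∨ L.leg y = _
  have hf : ∀ z, L.leg (L.faceFlip z) = L.leg z := fun z =>
    Eq.symm (by exact Quot.sound rfl)
  constructor
  · intro h
    rcases (L.edge_eq_edge_iff x y).1 h.symm with rfl | rfl | rfl | rfl
    · exact Or.inl rfl
    · exact Or.inr rfl
    · exact Or.inl (hf x)
    · rw [L.flip_comm]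
      exact Or.inr (hf _)
  · rintro (h | h)
    · exact congrArg Leg.edge h
    · exact (congrArg Leg.edge h).trans (L.edge_vertexFlip x)

theorem side_edge_eq_iff (x : Φ) (l : L.Side) :
    l.edge = L.edge x ↔ l = L.side x ∨ l = L.side (L.faceFlip x) := by
  induction l using Quot.ind with | _ y
  change L.edge y = L.edge x ↔ L.side y = _ ∨ L.side y = _
  have hf : ∀ z, L.side (L.vertexFlip z) = L.side z := fun z =>
    Eq.symm (by exact Quot.sound rfl)
  constructor
  · intro h
    rcases (L.edge_eq_edge_iff x y).1 h.symm with rfl | rfl | rfl | rfl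
    · exact Or.inl rfl
    · exact Or.inl (hf x)
    · exact Or.inr rfl
    · exact Or.inr (hf _)
  · rintro (h | h)
    · exact congrArg Side.edge h
    · exact (congrArg Side.edge h).trans (L.edge_faceFlip x)

/-! ### The maps between chains modulo two -/

section Chains

variable [Finite Φ]

/-- The set of edges flipped by the star operators of a set of vertices, both encoded by their
indicator functions modulo two. -/
noncomputable def starSum : (L.Vertex → ZMod 2) →ₗ[ZMod 2] (L.Edge → ZMod 2) where
  toFun h e := ∑ v, h v * (L.legs v e : ZMod 2)
  map_add' h h' := by
    ext e
    simp [add_mul, Finset.sum_add_distrib]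
  map_smul' c h := by
    ext e
    simp [Finset.mul_sum, mul_assoc]

/-- The parities with which a set of edges meets the boundaries of the faces: the eigenvalues of
the plaquette operators on a basis vector are `(-1) ^ faceParity s p`. -/
noncomputable def faceParity : (L.Edge → ZMod 2) →ₗ[ZMod 2] (L.Face → ZMod 2) where
  toFun s p := ∑ e, s e * (L.sides p e : ZMod 2)
  map_add' h h' := by
    ext e
    simp [add_mul, Finset.sum_add_distrib]
  map_smul' c h := by
    ext e
    simp [Finset.mul_sum, mul_assoc]

theorem starSum_apply (h : L.Vertex → ZMod 2) (e : L.Edge) :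
    L.starSum h e = ∑ v, h v * (L.legs v e : ZMod 2) := rfl

theorem faceParity_apply (s : L.Edge → ZMod 2) (p : L.Face) :
    L.faceParity s p = ∑ e, s e * (L.sides p e : ZMod 2) := rfl

theorem starSum_edge (h : L.Vertex → ZMod 2) (x : Φ) :
    L.starSum h (L.edge x) = h (L.vertex x) + h (L.vertex (L.vertexFlip x)) := by
  classical
  rw [starSum_apply]
  refine (sum_mul_card_incidence Leg.vertex Leg.edge h (L.edge x)).trans ?_
  have : Finset.univ.filter (fun l : L.Leg => l.edge = L.edge x)
      = {L.leg x, L.leg (L.vertexFlip x)} := by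
    ext l
    simp [leg_edge_eq_iff]
  rw [this, Finset.sum_pair (L.leg_ne_leg_vertexFlip x)]
  rfl

theorem sum_mul_sides_edge (f : L.Face → ZMod 2) (x : Φ) (hx : L.faceFlip x ≠ x) :
    ∑ p, f p * (L.sides p (L.edge x) : ZMod 2)
      = f (L.face x) + f (L.face (L.faceFlip x)) := by
  classical
  refine (sum_mul_card_incidence Side.face Side.edge f (L.edge x)).trans ?_
  have : Finset.univ.filter (fun l : L.Side => l.edge = L.edge x)
      = {L.side x, L.side (L.faceFlip x)} := by
    ext l
    simp [side_edge_eq_iff]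
  rw [this, Finset.sum_pair (L.side_ne_side_faceFlip x hx)]
  rfl

theorem sum_side (f : L.Face → ZMod 2) (s : L.Edge → ZMod 2) :
    ∑ q : L.Side, f q.face * s q.edge = ∑ p, f p * L.faceParity s p := by
  classical
  have : ∀ p, L.faceParity s p = ∑ q : L.Side with q.face = p, s q.edge := by
    intro p
    rw [faceParity_apply]
    refine Eq.trans ?_ (sum_mul_card_incidence Side.edge Side.face s p)
    refine Finset.sum_congr rfl fun e _ => ?_
    simp only [sides, and_comm]
  simp_rw [this, Finset.mul_sum]
  rw [← Finset.sum_fiberwise _ (Side.face (L := L))]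
  refine Finset.sum_congr rfl fun p _ => Finset.sum_congr rfl fun q hq => ?_
  rw [(Finset.mem_filter.1 hq).2]

theorem sum_leg (u : L.Vertex → ZMod 2) (z : L.Edge → ZMod 2) :
    ∑ l : L.Leg, u l.vertex * z l.edge = ∑ e, L.starSum u e * z e := by
  classical
  have : ∀ e, L.starSum u e = ∑ l : L.Leg with l.edge = e, u l.vertex := by
    intro e
    exact sum_mul_card_incidence Leg.vertex Leg.edge u e
  simp_rw [this, Finset.sum_mul]
  rw [← Finset.sum_fiberwise _ (Leg.edge (L := L))]
  refine Finset.sum_congr rfl fun p _ => Finset.sum_congr rfl fun q hq => ?_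
  rw [(Finset.mem_filter.1 hq).2]

theorem sum_mul_faceParity (f : L.Face → ZMod 2) (s : L.Edge → ZMod 2) :
    ∑ p, f p * L.faceParity s p = ∑ e, s e * ∑ p, f p * (L.sides p e : ZMod 2) := by
  simp_rw [faceParity_apply, Finset.mul_sum]
  rw [Finset.sum_comm]
  exact Finset.sum_congr rfl fun e _ => Finset.sum_congr rfl fun p _ => by ring

/-- Star and plaquette operators commute: the incidences of a vertex with a face are flags, which
`edgeFlip` groups into pairs. -/
theorem faceParity_starSum (h : L.Vertex → ZMod 2) : L.faceParity (L.starSum h) = 0 := by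
  classical
  have := Fintype.ofFinite Φ
  have main : ∀ f : L.Face → ZMod 2, ∑ p, f p * L.faceParity (L.starSum h) p = 0 := by
    intro f
    rw [← sum_side]
    have h1 : ∀ q : L.Side, f q.face * L.starSum h q.edge
        = ∑ x with L.side x = q, f (L.face x) * h (L.vertex x) := by
      intro q
      induction q using Quot.ind with | _ x
      refine Eq.trans ?_ (sum_fiber_quot_of_involutive L.vertexFlip_invol (L.vertexFlip_ne x)
        (fun x => f (L.face x) * h (L.vertex x))).symm
      rw [face_vertexFlip, ← mul_add, ← starSum_edge]
      rfl
    simp_rw [h1]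
    refine (Finset.sum_fiberwise Finset.univ L.side _).trans ?_
    exact sum_eq_zero_of_involutive L.edgeFlip_invol L.edgeFlip_ne _
      fun x => by rw [face_edgeFlip, vertex_edgeFlip]
  ext p
  simpa [Pi.single_apply] using main (Pi.single p 1)

end Chains

/-! ### Cohomology of a contractible region -/

variable {L}

/-- The sum of a function of the corners along a list of steps. -/
def holonomy (φ : L.Corner → ZMod 2) (w : List L.Step) : ZMod 2 :=
  (w.map fun s => φ s.1).sum

theorem holonomy_append (φ : L.Corner → ZMod 2) (w w' : List L.Step) :
    holonomy φ (w ++ w') = holonomy φ w + holonomy φ w' := by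
  simp [holonomy]

/-- The reverse of a walk. -/
def reverseWalk (w : List L.Step) : List L.Step :=
  (w.map fun s => (s.1, !s.2)).reverse

theorem holonomy_reverseWalk (φ : L.Corner → ZMod 2) (w : List L.Step) :
    holonomy φ (reverseWalk w) = holonomy φ w := by
  simp [holonomy, reverseWalk, List.sum_reverse, Function.comp_def]

theorem IsWalk.append {A : Set L.Edge} {w w' : List L.Step} {l m n : L.Node}
    (h : IsWalk A l w m) (h' : IsWalk A m w' n) : IsWalk A l (w ++ w') n := by
  induction w generalizing l with
  | nil => cases h; exact h'
  | cons s w ih => exact ⟨h.1, h.2.1, ih h.2.2⟩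

theorem Step.source_reverse (s : L.Step) : Step.source (s.1, !s.2) = Step.target s := by
  obtain ⟨c, _ | _⟩ := s <;> rfl

theorem Step.target_reverse (s : L.Step) : Step.target (s.1, !s.2) = Step.source s := by
  obtain ⟨c, _ | _⟩ := s <;> rfl

theorem IsWalk.reverse {A : Set L.Edge} {w : List L.Step} {m n : L.Node}
    (h : IsWalk A m w n) : IsWalk A n (reverseWalk w) m := by
  induction w generalizing m with
  | nil => exact Eq.symm h
  | cons s w ih =>
    have : reverseWalk (s :: w) = reverseWalk w ++ [(s.1, !s.2)] := by simp [reverseWalk]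
    rw [this]
    exact (ih h.2.2).append ⟨h.1, Step.source_reverse s, (Step.target_reverse s).trans h.2.1⟩

/-- A function of the corners is a cocycle modulo two on the region `A` if it sums to zero around
every tile of `A`. -/
def IsCocycle (A : Set L.Edge) (φ : L.Corner → ZMod 2) : Prop :=
  ∀ x, L.edge x ∈ A → φ (L.corner x) + φ (L.corner (L.vertexFlip x))
    = φ (L.corner (L.faceFlip x)) + φ (L.corner (L.vertexFlip (L.faceFlip x)))

theorem IsCocycle.holonomy_eq_of_homotopic {A : Set L.Edge} {φ : L.Corner → ZMod 2}
    (hφ : IsCocycle A φ) {m n : L.Node} {w w' : List L.Step} (h : Homotopic A m n w w') :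
    holonomy φ w = holonomy φ w' := by
  induction h with
  | rel w w' h =>
    obtain ⟨-, -, h⟩ := h
    cases h with
    | backtrack u v c b =>
      simp only [holonomy_append]
      simp [holonomy, CharTwo.add_self_eq_zero]
    | tile u v x hx =>
      simp only [holonomy_append]
      congr 2
      simpa [holonomy] using hφ x hx
  | refl w => rfl
  | symm w w' _ ih => exact ih.symm
  | trans w w' w'' _ _ ih ih' => exact ih.trans ih'

/-- The first cohomology modulo two of a simply connected region vanishes. -/
theorem IsCocycle.exists_potential {A : Set L.Edge} {φ : L.Corner → ZMod 2}
    (hφ : IsCocycle A φ) (hA : IsContractible A) :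
    ∃ g : L.Node → ZMod 2, ∀ x, L.edge x ∈ A →
      φ (L.corner x) = g (Sum.inl (L.vertex x)) + g (Sum.inr (L.face x)) := by
  -- The potential of a node is the holonomy of a walk to it from the base point of its component.
  let S : Setoid L.Node :=
    { r := fun m n => ∃ w, IsWalk A m w n
      iseqv :=
        { refl := fun m => ⟨[], rfl⟩
          symm := fun ⟨w, hw⟩ => ⟨_, hw.reverse⟩
          trans := fun ⟨w, hw⟩ ⟨w', hw'⟩ => ⟨_, hw.append hw'⟩ } }
  have hwalk : ∀ n : L.Node, ∃ w, IsWalk A (Quotient.mk S n).out w n :=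
    fun n => Quotient.mk_out (s := S) n
  choose W hW using hwalk
  refine ⟨fun n => holonomy φ (W n), fun x hx => ?_⟩
  have hs : IsWalk A (Sum.inl (L.vertex x)) [(L.corner x, true)] (Sum.inr (L.face x)) :=
    ⟨⟨x, hx, rfl⟩, rfl, rfl⟩
  have hbase : Quotient.mk S (Sum.inl (L.vertex x)) = Quotient.mk S (Sum.inr (L.face x)) :=
    Quotient.sound ⟨_, hs⟩
  have h1 := hW (Sum.inl (L.vertex x))
  have h2 := (hW (Sum.inr (L.face x))).reverse
  rw [← hbase] at h2
  have h0 := hφ.holonomy_eq_of_homotopic (hA.simplyConnected _ _ ((h1.append hs).append h2))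
  rw [holonomy_append, holonomy_append, holonomy_reverseWalk] at h0
  have h3 : holonomy φ [(L.corner x, true)] = φ (L.corner x) := by simp [holonomy]
  rw [h3] at h0
  change _ = (0 : ZMod 2) at h0
  change φ (L.corner x) = holonomy φ (W (Sum.inl (L.vertex x))) +
    holonomy φ (W (Sum.inr (L.face x)))
  clear h3
  generalize holonomy φ (W (Sum.inl (L.vertex x))) = a at *
  generalize holonomy φ (W (Sum.inr (L.face x))) = b at *
  generalize φ (L.corner x) = c at *
  revert a b c
  decide

end SurfaceLattice

namespace SurfaceLattice

variable {Φ : Type*} {L : SurfaceLattice Φ} {A : Set L.Edge}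

/-! ### Duality on a contractible region -/

/-- A face straddles the boundary of the region `A` if it has edges inside and outside. -/
def Straddles (A : Set L.Edge) (p : L.Face) : Prop :=
  (∃ x, L.face x = p ∧ L.edge x ∈ A) ∧ ∃ y, L.face y = p ∧ L.edge y ∉ A

/-- Otherwise the flags of the edges of `A` would be stable under all flips, hence all flags. -/
theorem exists_straddles (hne : A.Nonempty) (hB : Aᶜ.Nonempty) : ∃ p, Straddles A p := by
  by_contra h
  push Not at h
  obtain ⟨e, he⟩ := hne
  obtain ⟨e', he'⟩ := hB
  obtain ⟨x, rfl⟩ := L.edge_surjective e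
  obtain ⟨y, rfl⟩ := L.edge_surjective e'
  suffices hy : L.edge y ∈ A from he' hy
  clear he'
  induction L.connected x y with
  | refl => exact he
  | @tail a b _ hab ih =>
    by_contra hb
    rcases hab with rfl | rfl | rfl
    · exact hb (by rwa [edge_vertexFlip])
    · exact h (L.face a) ⟨⟨a, rfl, ih⟩, _, L.face_edgeFlip a, hb⟩
    · exact hb (by rwa [edge_faceFlip])

variable [Finite Φ]

/-- On a contractible region, a set of edges which meets every face inside the region evenly agrees
with the edges flipped by a product of star operators. The parity of an edge is written as the sum
of the values of a function `φ` at the two corners on one of its sides. As both sides give the same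
parity, `φ` is a cocycle, and a potential of `φ` gives the vertices. -/
theorem IsContractible.exists_eq_starSum (hA : IsContractible A) (s : L.Edge → ZMod 2)
    (hs : ∀ p, (∀ x, L.face x = p → L.edge x ∈ A) → L.faceParity s p = 0) :
    ∃ h, ∀ e ∈ A, s e = L.starSum h e := by
  let : Fintype (Quot fun a b => b = L.vertexFlip a) := Fintype.ofFinite _
  obtain ⟨φ, hφ⟩ := exists_orbit_potential L.vertexFlip_invol L.edgeFlip_invol L.edgeFlip_ne
    {x | L.edge x ∈ A} (fun x hx => by simpa [edge_vertexFlip] using hx)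
    (fun x _ => L.vertexFlip_ne x) (fun q : L.Side => s q.edge) (by
      intro τ hτD hτ
      have hv : ∀ x, τ (L.side (L.vertexFlip x)) = τ (L.side x) := fun x =>
        congrArg τ (Eq.symm (by exact Quot.sound rfl))
      -- A set of sides which is stable under `edgeFlip` consists of all sides of some faces.
      let f : L.Face → ZMod 2 := Quot.lift (fun x => τ (L.side x)) (by
        rintro a _ (rfl | rfl)
        · exact (hv a).symm
        · exact (hτ a).symm)
      have hf : ∀ q : L.Side, τ q = f q.face := fun q => Quot.inductionOn q fun x => rfl
      refine (Finset.sum_congr rfl fun q _ => by rw [hf q]).trans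
        ((L.sum_side f s).trans (Finset.sum_eq_zero fun p _ => ?_))
      by_cases hp : ∀ x, L.face x = p → L.edge x ∈ A
      · rw [hs p hp, mul_zero]
      · push Not at hp
        obtain ⟨x, rfl, hx⟩ := hp
        have : f (L.face x) = 0 := hτD x hx
        rw [this, zero_mul])
  obtain ⟨g, hg⟩ := IsCocycle.exists_potential (A := A) (φ := φ) (fun x hx => by
    have h1 : φ (L.corner x) + φ (L.corner (L.vertexFlip x)) = s (L.edge x) := hφ x hx
    have h2 : φ (L.corner (L.faceFlip x)) + φ (L.corner (L.vertexFlip (L.faceFlip x)))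
        = s (L.edge (L.faceFlip x)) := hφ (L.faceFlip x) (by simpa [edge_faceFlip] using hx)
    rw [h1, h2, edge_faceFlip]) hA
  refine ⟨fun v => g (Sum.inl v), fun e he => ?_⟩
  obtain ⟨x, rfl⟩ := L.edge_surjective e
  have h1 : φ (L.corner x) + φ (L.corner (L.vertexFlip x)) = s (L.edge x) := hφ x he
  rw [starSum_edge, ← h1, hg x he, hg _ (by rwa [edge_vertexFlip]), face_vertexFlip]
  generalize g _ = a
  generalize g _ = b
  generalize g _ = c
  revert a b c
  decide

/-- The dual of `IsContractible.exists_eq_starSum`: on a contractible region off the boundary of the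
surface, a cycle of edges is the sum of the boundaries of a set of faces. -/
theorem IsContractible.exists_eq_sum_sides (hA : IsContractible A)
    (hint : ∀ x, L.edge x ∈ A → L.faceFlip x ≠ x) (z : L.Edge → ZMod 2)
    (hz : ∀ u, ∑ e, L.starSum u e * z e = 0) :
    ∃ f : L.Face → ZMod 2, ∀ e ∈ A, z e = ∑ p, f p * (L.sides p e : ZMod 2) := by
  let : Fintype (Quot fun a b => b = L.faceFlip a) := Fintype.ofFinite _
  obtain ⟨φ, hφ⟩ := exists_orbit_potential L.faceFlip_invol L.edgeFlip_invol L.edgeFlip_ne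
    {x | L.edge x ∈ A} (fun x hx => by simpa [edge_faceFlip] using hx)
    hint (fun q : L.Leg => z q.edge) (by
      intro τ _ hτ
      have hv : ∀ x, τ (L.leg (L.faceFlip x)) = τ (L.leg x) := fun x =>
        congrArg τ (Eq.symm (by exact Quot.sound rfl))
      -- A set of legs which is stable under `edgeFlip` consists of all legs of some vertices.
      let u : L.Vertex → ZMod 2 := Quot.lift (fun x => τ (L.leg x)) (by
        rintro a _ (rfl | rfl)
        · exact (hτ a).symm
        · exact (hv a).symm)
      have hu : ∀ q : L.Leg, τ q = u q.vertex := fun q => Quot.inductionOn q fun x => rfl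
      exact (Finset.sum_congr rfl fun q _ => by rw [hu q]).trans ((L.sum_leg u z).trans (hz u)))
  have hφ' : ∀ x, L.edge x ∈ A → φ (L.corner x) + φ (L.corner (L.faceFlip x)) = z (L.edge x) :=
    fun x hx => hφ x hx
  obtain ⟨g, hg⟩ := IsCocycle.exists_potential (A := A) (φ := φ) (fun x hx => by
    have h1 := hφ' x hx
    have h2 := hφ' (L.vertexFlip x) (by rwa [edge_vertexFlip])
    rw [edge_vertexFlip, ← h1, ← L.flip_comm] at h2
    generalize φ (L.corner x) = a at *
    generalize φ (L.corner (L.vertexFlip x)) = b at *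
    generalize φ (L.corner (L.faceFlip x)) = c at *
    generalize φ (L.corner (L.vertexFlip (L.faceFlip x))) = d at *
    clear h1
    revert a b c d
    decide) hA
  refine ⟨fun p => g (Sum.inr p), fun e he => ?_⟩
  obtain ⟨x, rfl⟩ := L.edge_surjective e
  rw [sum_mul_sides_edge _ _ _ (hint x he), ← hφ' x he, hg x he, hg _ (by rwa [edge_faceFlip]),
    vertex_faceFlip]
  generalize g _ = a
  generalize g _ = b
  generalize g _ = c
  revert a b c
  decide

/-- A product of `σˣ` over edges of a contractible region which commutes with all plaquette
operators is a product of star operators: it pairs to zero with every cycle, since the cycle is a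
sum of boundaries of faces on the region. -/
theorem IsContractible.mem_range_starSum (hA : IsContractible A)
    (hint : ∀ x, L.edge x ∈ A → L.faceFlip x ≠ x) (s : L.Edge → ZMod 2)
    (hsA : ∀ e ∉ A, s e = 0) (hs : L.faceParity s = 0) :
    s ∈ LinearMap.range L.starSum := by
  refine mem_of_forall_dotProduct_eq_zero _ _ fun z hz => ?_
  obtain ⟨f, hf⟩ := hA.exists_eq_sum_sides hint z fun u => by
    simpa only [mul_comm] using hz _ ⟨u, rfl⟩
  have h := L.sum_mul_faceParity f s
  simp only [hs, Pi.zero_apply, mul_zero, Finset.sum_const_zero] at h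
  rw [h]
  refine Finset.sum_congr rfl fun e _ => ?_
  by_cases he : e ∈ A
  · rw [hf e he, mul_comm]
  · rw [hsA e he, zero_mul, mul_zero]

/-! ### Counting the configurations of a region -/

/-- A path of the dual graph inside the region joins any two faces which touch it: a set of edges of
`A` which meets exactly these two faces oddly (none if they coincide), as is expressed by pairing the
parities with functions `f` of the faces. -/
theorem IsContractible.exists_faceParity_eq (hA : IsContractible A)
    (hint : ∀ x, L.edge x ∈ A → L.faceFlip x ≠ x) {x y : Φ} (hx : L.edge x ∈ A)
    (hy : L.edge y ∈ A) :
    ∃ s : L.Edge → ZMod 2, (∀ e ∉ A, s e = 0) ∧ ∀ f : L.Face → ZMod 2,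
      ∑ p, f p * L.faceParity s p = f (L.face x) + f (L.face y) := by
  classical
  have hedge : ∀ x y : Φ, L.edge x = L.edge y → L.edge x ∈ A →
      ∃ s : L.Edge → ZMod 2, (∀ e ∉ A, s e = 0) ∧ ∀ f : L.Face → ZMod 2,
        ∑ p, f p * L.faceParity s p = f (L.face x) + f (L.face y) := by
    intro x y hxy hx
    have hsame : ∃ s : L.Edge → ZMod 2, (∀ e ∉ A, s e = 0) ∧ ∀ f : L.Face → ZMod 2,
        ∑ p, f p * L.faceParity s p = f (L.face x) + f (L.face x) :=
      ⟨0, fun _ _ => rfl, fun f => by simp [CharTwo.add_self_eq_zero]⟩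
    have hother : ∃ s : L.Edge → ZMod 2, (∀ e ∉ A, s e = 0) ∧ ∀ f : L.Face → ZMod 2,
        ∑ p, f p * L.faceParity s p = f (L.face x) + f (L.face (L.faceFlip x)) := by
      refine ⟨Pi.single (L.edge x) 1, fun e he => ?_, fun f => ?_⟩
      · rw [Pi.single_apply, if_neg]
        rintro rfl
        exact he hx
      · rw [sum_mul_faceParity, ← sum_mul_sides_edge _ _ _ (hint x hx)]
        simp [Pi.single_apply]
    rcases (L.edge_eq_edge_iff x y).1 hxy with rfl | rfl | rfl | rfl
    · exact hsame
    · rwa [face_vertexFlip]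
    · exact hother
    · rwa [face_vertexFlip]
  have key : ∀ e', Relation.ReflTransGen
      (fun a b => b ∈ A ∧ ∃ x y, L.edge x = a ∧ L.edge y = b ∧ L.face x = L.face y)
        (L.edge x) e' → e' ∈ A ∧ ∀ y, L.edge y = e' →
      ∃ s : L.Edge → ZMod 2, (∀ e ∉ A, s e = 0) ∧ ∀ f : L.Face → ZMod 2,
        ∑ p, f p * L.faceParity s p = f (L.face x) + f (L.face y) := by
    intro e' h
    induction h with
    | refl => exact ⟨hx, fun y hy => hedge x y hy.symm hx⟩
    | @tail a b _ hab ih =>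
      obtain ⟨hb, x', y', hx', hy', hf⟩ := hab
      refine ⟨hb, fun y hy => ?_⟩
      obtain ⟨s, hsA, hs⟩ := ih.2 x' hx'
      obtain ⟨t, htA, ht⟩ := hedge y' y (hy'.trans hy.symm) (hy' ▸ hb)
      refine ⟨s + t, fun e he => by simp [hsA e he, htA e he], fun f => ?_⟩
      simp only [map_add, Pi.add_apply, mul_add, Finset.sum_add_distrib, hs, ht, hf]
      generalize f _ = a
      generalize f _ = b
      generalize f _ = c
      revert a b c
      decide
  exact (key _ (hA.connected _ hx _ hy)).2 y rfl

variable (A)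

/-- The sets of edges of `A` whose product of `σˣ` commutes with all plaquette operators except
possibly those of straddling faces. -/
def innerCycles : Submodule (ZMod 2) (L.Edge → ZMod 2) where
  carrier := {s | (∀ e ∉ A, s e = 0) ∧ ∀ p, ¬ Straddles A p → L.faceParity s p = 0}
  zero_mem' := ⟨fun _ _ => rfl, fun p _ => by simp⟩
  add_mem' := fun ha hb => ⟨fun e he => by simp [ha.1 e he, hb.1 e he],
    fun p hp => by simp [ha.2 p hp, hb.2 p hp]⟩
  smul_mem' := fun c s hs => ⟨fun e he => by simp [hs.1 e he],
    fun p hp => by simp [hs.2 p hp]⟩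

/-- The sets of edges of `A` whose product of `σˣ` commutes with all plaquette operators: the cycles
of the dual lattice in `A`. -/
def cycles : Submodule (ZMod 2) (L.Edge → ZMod 2) where
  carrier := {s | (∀ e ∉ A, s e = 0) ∧ L.faceParity s = 0}
  zero_mem' := ⟨fun _ _ => rfl, by simp⟩
  add_mem' := fun ha hb => ⟨fun e he => by simp [ha.1 e he, hb.1 e he],
    by simp [ha.2, hb.2]⟩
  smul_mem' := fun c s hs => ⟨fun e he => by simp [hs.1 e he], by simp [hs.2]⟩

theorem mem_cycles {s : L.Edge → ZMod 2} : s ∈ cycles A ↔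
    (∀ e ∉ A, s e = 0) ∧ L.faceParity s = 0 := Iff.rfl

theorem cycles_le_innerCycles : cycles A ≤ innerCycles A :=
  fun _ hs => ⟨hs.1, fun p _ => congrFun hs.2 p⟩

variable {A}

theorem faceParity_congr {s t : L.Edge → ZMod 2} {p : L.Face}
    (h : ∀ x, L.face x = p → s (L.edge x) = t (L.edge x)) :
    L.faceParity s p = L.faceParity t p := by
  classical
  have hp : ∀ s : L.Edge → ZMod 2, L.faceParity s p
      = ∑ q : L.Side, (Pi.single p 1 : L.Face → ZMod 2) q.face * s q.edge := by
    intro s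
    rw [sum_side]
    simp [Pi.single_apply]
  rw [hp, hp]
  refine Finset.sum_congr rfl fun q _ => ?_
  induction q using Quot.ind with | _ x
  change (Pi.single p 1 : L.Face → ZMod 2) (L.face x) * s (L.edge x)
    = (Pi.single p 1 : L.Face → ZMod 2) (L.face x) * t (L.edge x)
  by_cases hx : L.face x = p
  · rw [h x hx]
  · rw [Pi.single_apply, if_neg hx, zero_mul, zero_mul]

theorem sum_faceParity_eq_zero (hint : ∀ x, L.edge x ∈ A → L.faceFlip x ≠ x)
    {s : L.Edge → ZMod 2} (hsA : ∀ e ∉ A, s e = 0) : ∑ p, L.faceParity s p = 0 := by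
  have h := L.sum_mul_faceParity 1 s
  simp only [Pi.one_apply, one_mul] at h
  rw [h]
  refine Finset.sum_eq_zero fun e _ => ?_
  by_cases he : e ∈ A
  · obtain ⟨x, rfl⟩ := L.edge_surjective e
    have h1 := L.sum_mul_sides_edge 1 x (hint x he)
    simp only [Pi.one_apply, one_mul] at h1
    rw [h1, CharTwo.add_self_eq_zero, mul_zero]
  · rw [hsA e he, zero_mul]

/-- The parities of the inner cycles at the straddling faces are arbitrary except that their sum is
even, and they vanish exactly for the cycles. -/
theorem IsContractible.finrank_innerCycles (hA : IsContractible A)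
    (hint : ∀ x, L.edge x ∈ A → L.faceFlip x ≠ x) (hne : A.Nonempty) (hB : Aᶜ.Nonempty) :
    Module.finrank (ZMod 2) (innerCycles A) + 1
      = Module.finrank (ZMod 2) (cycles A) + numStraddling A := by
  classical
  obtain ⟨p₀, hp₀⟩ := exists_straddles hne hB
  let β : innerCycles A →ₗ[ZMod 2] ({p // Straddles A p} → ZMod 2) :=
    (LinearMap.funLeft (ZMod 2) (ZMod 2) (Subtype.val : {p : L.Face // Straddles A p} → L.Face)) ∘ₗ
      L.faceParity ∘ₗ (innerCycles A).subtype
  have hβ : ∀ w p, β w p = L.faceParity w.1 p.1 := fun _ _ => rfl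
  let total : ({p // Straddles A p} → ZMod 2) →ₗ[ZMod 2] ZMod 2 :=
    Fintype.linearCombination (ZMod 2) (fun _ => 1)
  have htot : ∀ y, total y = ∑ p, y p := fun y => by simp [total, Fintype.linearCombination_apply]
  have hrange : LinearMap.range β = LinearMap.ker total := by
    apply le_antisymm
    · rintro _ ⟨w, rfl⟩
      rw [LinearMap.mem_ker, htot, ← sum_faceParity_eq_zero hint w.2.1]
      simp_rw [hβ]
      rw [← Finset.sum_filter_add_sum_filter_not Finset.univ (Straddles A),
        Finset.sum_eq_zero (s := Finset.univ.filter fun p => ¬ Straddles A p)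
          (fun p hp => w.2.2 p (Finset.mem_filter.1 hp).2), add_zero]
      exact (Finset.sum_subtype _ (by simp) _).symm
    · intro y hy
      rw [LinearMap.mem_ker, htot] at hy
      obtain ⟨x₀, hx₀, hx₀A⟩ := hp₀.1
      have hpath : ∀ p : {p // Straddles A p}, ∃ w : innerCycles A,
          β w = Pi.single p 1 + Pi.single ⟨p₀, hp₀⟩ 1 := by
        intro p
        obtain ⟨x, hx, hxA⟩ := p.2.1
        obtain ⟨s, hsA, hs⟩ := hA.exists_faceParity_eq hint hxA hx₀A
        have hs' : ∀ q, L.faceParity s q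
            = (Pi.single p.1 1 : L.Face → ZMod 2) q + (Pi.single p₀ 1 : L.Face → ZMod 2) q := by
          intro q
          have := hs (Pi.single q 1)
          rw [hx, hx₀] at this
          simpa [Pi.single_apply, eq_comm] using this
        refine ⟨⟨s, hsA, fun q hq => ?_⟩, ?_⟩
        · rw [hs', Pi.single_apply, Pi.single_apply, if_neg, if_neg, add_zero]
          · rintro rfl; exact hq hp₀
          · rintro rfl; exact hq p.2
        · ext q
          rw [hβ, hs']
          simp [Pi.single_apply, Subtype.ext_iff]
      choose w hw using hpath
      -- The contributions at `p₀` cancel because the sum of `y` is even.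
      refine ⟨∑ p, y p • w p, ?_⟩
      ext q
      simp [hw, Finset.sum_add_distrib, Pi.single_apply, hy]
  have hker : Module.finrank (ZMod 2) (LinearMap.ker β) = Module.finrank (ZMod 2) (cycles A) := by
    suffices h : LinearMap.ker β = (cycles A).submoduleOf (innerCycles A) by
      rw [h]
      exact (Submodule.submoduleOfEquivOfLe (cycles_le_innerCycles A)).finrank_eq
    ext w
    change β w = 0 ↔ w.1 ∈ cycles A
    rw [mem_cycles]
    constructor
    · intro h
      refine ⟨w.2.1, ?_⟩
      ext p
      by_cases hp : Straddles A p
      · exact congrFun h ⟨p, hp⟩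
      · exact w.2.2 p hp
    · intro h
      ext p
      exact congrFun h.2 p.1
  have h1 := LinearMap.finrank_range_add_finrank_ker β
  have h2 := LinearMap.finrank_range_add_finrank_ker total
  have hsurj : LinearMap.range total = ⊤ := by
    rw [LinearMap.range_eq_top]
    intro c
    exact ⟨Pi.single ⟨p₀, hp₀⟩ c, by rw [htot]; simp [Pi.single_apply]⟩
  have h3 : Module.finrank (ZMod 2) ({p // Straddles A p} → ZMod 2) = numStraddling A := by
    rw [Module.finrank_fintype_fun_eq_card, ← Nat.card_eq_fintype_card]
    rfl
  rw [hrange, hker] at h1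
  rw [hsurj, finrank_top, Module.finrank_self, h3] at h2
  omega

theorem indicator_mem_innerCycles {s : L.Edge → ZMod 2} (hs : L.faceParity s = 0) :
    A.indicator s ∈ innerCycles A := by
  refine ⟨fun e he => Set.indicator_of_notMem he _, fun p hp => ?_⟩
  by_cases hpA : ∃ x, L.face x = p ∧ L.edge x ∈ A
  · rw [faceParity_congr (t := s), hs, Pi.zero_apply]
    intro x hx
    refine Set.indicator_of_mem ?_ _
    by_contra hxA
    exact hp ⟨hpA, x, hx, hxA⟩
  · rw [faceParity_congr (t := 0), map_zero, Pi.zero_apply]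
    exact fun x hx => Set.indicator_of_notMem (fun hxA => hpA ⟨x, hx, hxA⟩) _

/-- On a contractible region, the inner cycles are restrictions of products of star operators. -/
theorem IsContractible.exists_indicator_starSum_eq (hA : IsContractible A) {s : L.Edge → ZMod 2}
    (hs : s ∈ innerCycles A) : ∃ h, A.indicator (L.starSum h) = s := by
  obtain ⟨h, hh⟩ := hA.exists_eq_starSum s fun p hp => hs.2 p fun hp' => by
    obtain ⟨-, y, hy, hyA⟩ := hp'
    exact hyA (hp y hy)
  refine ⟨h, ?_⟩
  ext e
  by_cases he : e ∈ A
  · rw [Set.indicator_of_mem he, hh e he]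
  · rw [Set.indicator_of_notMem he, hs.1 e he]

end SurfaceLattice

/-! ### Entanglement of states with a flat Schmidt spectrum -/

section FlatSpectrum

open Matrix

theorem cfcSqrt_of_mul_self_eq_smul {n : Type*} [Fintype n] [DecidableEq n] {ρ : Matrix n n ℂ}
    (hρ : ρ.PosSemidef) {c : ℝ} (hc : 0 < c) (h : ρ * ρ = ((c ^ 2 : ℝ) : ℂ) • ρ) :
    CFC.sqrt ρ = ((c⁻¹ : ℝ) : ℂ) • ρ := by
  refine CFC.sqrt_unique ?_ ?_
  · rw [smul_mul_smul_comm, h, smul_smul, ← Complex.ofReal_mul, ← Complex.ofReal_mul]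
    have : c⁻¹ * c⁻¹ * c ^ 2 = 1 := by field_simp
    rw [this, Complex.ofReal_one, one_smul]
  · rw [Matrix.nonneg_iff_posSemidef]
    exact hρ.smul (by exact_mod_cast (inv_pos.2 hc).le)

open Classical in
theorem renyiHalf_eq_logb_trace {n : Type*} [hn : Finite n] [hn' : Fintype n] (ρ : Matrix n n ℂ) :
    renyiHalf ρ = 2 * Real.logb 2 (CFC.sqrt ρ).trace.re := by
  obtain rfl : hn' = @Fintype.ofFinite n hn := Subsingleton.elim _ _
  rfl

open Classical in
theorem renyiHalf_of_mul_self_eq_smul {n : Type*} [Fintype n] {ρ : Matrix n n ℂ}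
    (hρ : ρ.PosSemidef) (htr : ρ.trace = 1) {l : ℝ} (hl : 0 < l) (h : ρ * ρ = (l : ℂ) • ρ) :
    renyiHalf ρ = Real.logb 2 l⁻¹ := by
  have hs : CFC.sqrt ρ = (((√l)⁻¹ : ℝ) : ℂ) • ρ :=
    cfcSqrt_of_mul_self_eq_smul hρ (Real.sqrt_pos.2 hl) (by rw [Real.sq_sqrt hl.le, h])
  rw [renyiHalf_eq_logb_trace, hs, trace_smul, htr, smul_eq_mul, mul_one, Complex.ofReal_re,
    ← Real.sqrt_inv, Real.sqrt_eq_rpow, Real.logb_rpow_eq_mul_logb_of_pos (inv_pos.2 hl)]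
  ring

/-- The equation says that the eigenvalues of `R` are `0` and `± l`, so that `|R| = l⁻¹ R²`. -/
theorem trace_abs_of_mul_self_mul_self {n : Type*} [Fintype n] [DecidableEq n] {R : Matrix n n ℂ}
    (hR : R.IsHermitian) (htr : (R * R).trace = 1) {l : ℝ} (hl : 0 < l)
    (h : R * R * R = ((l ^ 2 : ℝ) : ℂ) • R) : (CFC.abs R).trace.re = l⁻¹ := by
  have hR' : star R = R := hR
  have hN : (R * R).PosSemidef := by
    have := posSemidef_conjTranspose_mul_self R
    rwa [hR.eq] at this
  have h4 : (R * R) * (R * R) = ((l ^ 2 : ℝ) : ℂ) • (R * R) := by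
    rw [← mul_assoc, h, smul_mul_assoc]
  rw [CFC.abs, hR', cfcSqrt_of_mul_self_eq_smul hN hl h4, trace_smul, htr]
  simp

section CrossedAmplitudes

variable {m n : Type*} (M : Matrix m n ℂ)

/-- The matrix whose `((a, b), (a', b'))` entry is the product of the `(a', b)` entry of `M` and of
the conjugate of its `(a, b')` entry: the partial transpose of the pure state with amplitudes
`M`. -/
def crossedAmplitudes (M : Matrix m n ℂ) : Matrix (m × n) (m × n) ℂ :=
  Matrix.of fun i j => M j.1 i.2 * star (M i.1 j.2)

theorem crossedAmplitudes_isHermitian : (crossedAmplitudes M).IsHermitian := by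
  ext i j
  simp [crossedAmplitudes, mul_comm]

variable [Fintype m] [Fintype n]

theorem crossedAmplitudes_mul_self (i j : m × n) :
    (crossedAmplitudes M * crossedAmplitudes M) i j = (M * Mᴴ) j.1 i.1 * (Mᴴ * M) j.2 i.2 := by
  simp only [mul_apply, crossedAmplitudes, of_apply, conjTranspose_apply, Fintype.sum_prod_type,
    Finset.sum_mul_sum]
  rw [Finset.sum_comm]
  exact Finset.sum_congr rfl fun _ _ => Finset.sum_congr rfl fun _ _ => by ring

theorem crossedAmplitudes_mul_self_mul_self (i j : m × n) :
    (crossedAmplitudes M * crossedAmplitudes M * crossedAmplitudes M) i j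
      = (M * Mᴴ * M) j.1 i.2 * star ((M * Mᴴ * M) i.1 j.2) := by
  have h : star ((M * Mᴴ * M) i.1 j.2) = (Mᴴ * (M * Mᴴ)) j.2 i.1 := by
    rw [← conjTranspose_apply, conjTranspose_mul, conjTranspose_mul, conjTranspose_conjTranspose]
  rw [h, Matrix.mul_assoc M, mul_apply, mul_apply, mul_apply (M := Mᴴ), Finset.sum_mul_sum,
    Fintype.sum_prod_type, Finset.sum_comm]
  refine Finset.sum_congr rfl fun b _ => Finset.sum_congr rfl fun a _ => ?_
  rw [crossedAmplitudes_mul_self]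
  simp only [crossedAmplitudes, of_apply, conjTranspose_apply]
  ring

theorem trace_crossedAmplitudes_mul_self :
    (crossedAmplitudes M * crossedAmplitudes M).trace = (M * Mᴴ).trace * (M * Mᴴ).trace := by
  conv_rhs => rhs; rw [trace_mul_comm]
  simp only [trace, diag_apply, crossedAmplitudes_mul_self, Fintype.sum_prod_type, Finset.sum_mul_sum]

end CrossedAmplitudes

variable {E : Type*}

open Classical in
/-- Configurations on `A` and on its complement make up a configuration. -/
noncomputable def mergeEquiv (A : Set E) :
    (A → Fin 2) × ({e // e ∉ A} → Fin 2) ≃ (E → Fin 2) :=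
  (Equiv.piEquivPiSubtypeProd (fun e => e ∈ A) (fun _ => Fin 2)).symm

open Classical in
theorem mergeEquiv_apply (A : Set E) (a : A → Fin 2) (b : {e // e ∉ A} → Fin 2) (e : E) :
    mergeEquiv A (a, b) e = if h : e ∈ A then a ⟨e, h⟩ else b ⟨e, h⟩ := rfl

/-- The matrix of amplitudes of a state, with rows for the configurations on `A` and columns for
those on the complement of `A`. -/
noncomputable def amplitudes (A : Set E) (ψ : (E → Fin 2) → ℂ) :
    Matrix (A → Fin 2) ({e // e ∉ A} → Fin 2) ℂ :=
  Matrix.of fun a b => ψ (mergeEquiv A (a, b))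

theorem partialTranspose_pureState (A : Set E) (ψ : (E → Fin 2) → ℂ) :
    partialTranspose A (pureState ψ)
      = (crossedAmplitudes (amplitudes A ψ)).submatrix (mergeEquiv A).symm (mergeEquiv A).symm := by
  ext s t
  obtain ⟨⟨a, b⟩, rfl⟩ := (mergeEquiv A).surjective s
  obtain ⟨⟨a', b'⟩, rfl⟩ := (mergeEquiv A).surjective t
  simp only [submatrix_apply, Equiv.symm_apply_apply, crossedAmplitudes, of_apply, amplitudes,
    partialTranspose, pureState]
  refine congrArg₂ (· * ·) (congrArg ψ ?_) (congrArg (fun z => star (ψ z)) ?_)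
  · ext e
    by_cases he : e ∈ A <;> simp [mergeEquiv_apply, he]
  · ext e
    by_cases he : e ∈ A <;> simp [mergeEquiv_apply, he]

variable [Fintype E] [DecidableEq E]

open Classical in
theorem reducedState_pureState (A : Set E) (ψ : (E → Fin 2) → ℂ) :
    reducedState A (pureState ψ) = amplitudes A ψ * (amplitudes A ψ)ᴴ := by
  ext a a'
  rw [mul_apply]
  rfl

open Classical in
theorem trace_amplitudes (A : Set E) {ψ : (E → Fin 2) → ℂ} (hψ : ∑ s, ‖ψ s‖ ^ 2 = 1) :
    (amplitudes A ψ * (amplitudes A ψ)ᴴ).trace = 1 := by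
  have h : ∑ s, ψ s * star (ψ s) = 1 := by
    rw [← Complex.ofReal_one, ← hψ, Complex.ofReal_sum]
    refine Finset.sum_congr rfl fun s _ => ?_
    rw [Complex.ofReal_pow]
    exact Complex.mul_conj' (ψ s)
  rw [← h, ← (mergeEquiv A).sum_comp, Fintype.sum_prod_type]
  simp [trace, mul_apply, amplitudes]

open Classical in
/-- If all nonzero squared Schmidt coefficients of a state equal `l`, which is what the matrix
equation says, then its logarithmic negativity and its Rényi entropy of index `1/2` equal
`log₂ l⁻¹`. -/
theorem entanglement_of_flat_spectrum (A : Set E) {ψ : (E → Fin 2) → ℂ}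
    (hψ : ∑ s, ‖ψ s‖ ^ 2 = 1) {l : ℝ} (hl : 0 < l)
    (h : amplitudes A ψ * (amplitudes A ψ)ᴴ * amplitudes A ψ = (l : ℂ) • amplitudes A ψ) :
    logNegativity A (pureState ψ) = Real.logb 2 l⁻¹ ∧
      renyiHalf (reducedState A (pureState ψ)) = Real.logb 2 l⁻¹ := by
  have htr := trace_amplitudes A hψ
  constructor
  · rw [logNegativity, trace_abs_of_mul_self_mul_self (l := l) ?_ ?_ hl ?_]
    · rw [partialTranspose_pureState]
      exact (crossedAmplitudes_isHermitian _).submatrix _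
    · rw [partialTranspose_pureState, submatrix_mul_equiv]
      have := trace_crossedAmplitudes_mul_self (amplitudes A ψ)
      rw [htr, one_mul] at this
      rw [← this]
      exact (mergeEquiv A).symm.sum_comp
        fun i => (crossedAmplitudes (amplitudes A ψ) * crossedAmplitudes (amplitudes A ψ)) i i
    · rw [partialTranspose_pureState, submatrix_mul_equiv, submatrix_mul_equiv]
      ext s t
      rw [submatrix_apply, crossedAmplitudes_mul_self_mul_self, h]
      simp [crossedAmplitudes]
      ring
  · rw [reducedState_pureState]
    refine renyiHalf_of_mul_self_eq_smul (posSemidef_self_mul_conjTranspose _) htr hl ?_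
    rw [← Matrix.mul_assoc, h, Matrix.smul_mul]

end FlatSpectrum

/-! ### Products of Pauli matrices -/

theorem pauliX_pow_apply (k : ℕ) (i j : ZMod 2) :
    (pauliX ^ k : Matrix (Fin 2) (Fin 2) ℂ) i j = if j = i + (k : ZMod 2) then 1 else 0 := by
  have h2 : pauliX * pauliX = 1 := by
    ext i j
    fin_cases i <;> fin_cases j <;> simp [pauliX, Matrix.mul_apply]
  have hz : ∀ i : ZMod 2, i = 0 ∨ i = 1 := by decide
  have hX : ∀ i j : ZMod 2, (pauliX : Matrix (Fin 2) (Fin 2) ℂ) i j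
      = if j = i + 1 then 1 else 0 := by
    intro i j
    rcases hz i with rfl | rfl <;> rcases hz j with rfl | rfl
    · exact (show pauliX (0 : Fin 2) (0 : Fin 2) = 0 by simp [pauliX]).trans
        (if_neg (by decide)).symm
    · exact (show pauliX (0 : Fin 2) (1 : Fin 2) = 1 by simp [pauliX]).trans
        (if_pos (by decide)).symm
    · exact (show pauliX (1 : Fin 2) (0 : Fin 2) = 1 by simp [pauliX]).trans
        (if_pos (by decide)).symm
    · exact (show pauliX (1 : Fin 2) (1 : Fin 2) = 0 by simp [pauliX]).trans
        (if_neg (by decide)).symm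
  have h1 : ∀ i j : ZMod 2, (1 : Matrix (Fin 2) (Fin 2) ℂ) i j = if j = i then 1 else 0 := by
    intro i j
    by_cases h : j = i
    · subst h
      exact (Matrix.one_apply_eq _).trans (if_pos rfl).symm
    · exact (Matrix.one_apply_ne (Ne.symm h)).trans (if_neg h).symm
  rcases Nat.even_or_odd' k with ⟨m, rfl | rfl⟩
  · rw [pow_mul, pow_two, h2, one_pow, h1]
    simp [CharTwo.two_eq_zero]
  · rw [pow_succ, pow_mul, pow_two, h2, one_pow, one_mul, hX]
    simp [CharTwo.two_eq_zero]

/-- The sign `(-1) ^ z` of a residue modulo two. -/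
noncomputable def paritySign (z : ZMod 2) : ℂ := if z = 0 then 1 else -1

theorem paritySign_add (a b : ZMod 2) : paritySign (a + b) = paritySign a * paritySign b := by
  have hab : ∀ a b : ZMod 2, (a = 0 ∧ b = 0 ∧ a + b = 0) ∨ (a = 0 ∧ b ≠ 0 ∧ a + b ≠ 0) ∨
    (a ≠ 0 ∧ b = 0 ∧ a + b ≠ 0) ∨ (a ≠ 0 ∧ b ≠ 0 ∧ a + b = 0) := by decide
  rcases hab a b with ⟨h1, h2, h3⟩ | ⟨h1, h2, h3⟩ | ⟨h1, h2, h3⟩ | ⟨h1, h2, h3⟩ <;>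
    simp [paritySign, h1, h2, h3]

theorem paritySign_sum {ι : Type*} (s : Finset ι) (f : ι → ZMod 2) :
    paritySign (∑ i ∈ s, f i) = ∏ i ∈ s, paritySign (f i) := by
  classical
  induction s using Finset.induction_on with
  | empty => simp [paritySign]
  | insert a s ha ih => rw [Finset.sum_insert ha, Finset.prod_insert ha, paritySign_add, ih]

theorem pauliZ_pow_apply (k : ℕ) (i j : ZMod 2) :
    (pauliZ ^ k : Matrix (Fin 2) (Fin 2) ℂ) i j
      = if j = i then paritySign (i * (k : ZMod 2)) else 0 := by
  have h2 : pauliZ * pauliZ = 1 := by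
    ext i j
    fin_cases i <;> fin_cases j <;> simp [pauliZ, Matrix.mul_apply]
  have hz : ∀ i : ZMod 2, i = 0 ∨ i = 1 := by decide
  have hZ : ∀ i j : ZMod 2, (pauliZ : Matrix (Fin 2) (Fin 2) ℂ) i j
      = if j = i then paritySign i else 0 := by
    intro i j
    rcases hz i with rfl | rfl <;> rcases hz j with rfl | rfl
    · exact (show pauliZ (0 : Fin 2) (0 : Fin 2) = 1 by simp [pauliZ]).trans
        (by simp [paritySign])
    · exact (show pauliZ (0 : Fin 2) (1 : Fin 2) = 0 by simp [pauliZ]).trans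
        (if_neg (by decide)).symm
    · exact (show pauliZ (1 : Fin 2) (0 : Fin 2) = 0 by simp [pauliZ]).trans
        (if_neg (by decide)).symm
    · exact (show pauliZ (1 : Fin 2) (1 : Fin 2) = -1 by simp [pauliZ]).trans
        (by simp [paritySign])
  have h1 : ∀ i j : ZMod 2, (1 : Matrix (Fin 2) (Fin 2) ℂ) i j = if j = i then 1 else 0 := by
    intro i j
    by_cases h : j = i
    · subst h
      exact (Matrix.one_apply_eq _).trans (if_pos rfl).symm
    · exact (Matrix.one_apply_ne (Ne.symm h)).trans (if_neg h).symm
  rcases Nat.even_or_odd' k with ⟨m, rfl | rfl⟩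
  · rw [pow_mul, pow_two, h2, one_pow, h1]
    simp [CharTwo.two_eq_zero, paritySign]
  · rw [pow_succ, pow_mul, pow_two, h2, one_pow, one_mul, hZ]
    simp [CharTwo.two_eq_zero]

theorem tensorOp_pauliX_mulVec {E : Type*} [Fintype E] [DecidableEq E] (k : E → ℕ)
    (ψ : (E → ZMod 2) → ℂ) (s : E → ZMod 2) :
    Matrix.mulVec (tensorOp fun e => pauliX ^ k e) ψ s = ψ (s + fun e => (k e : ZMod 2)) := by
  classical
  have h : ∀ t : E → ZMod 2, tensorOp (fun e => pauliX ^ k e) s t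
      = if t = s + (fun e => (k e : ZMod 2)) then 1 else 0 := by
    intro t
    have : tensorOp (fun e => pauliX ^ k e) s t
        = ∏ e, if t e = s e + (k e : ZMod 2) then (1 : ℂ) else 0 :=
      Finset.prod_congr rfl fun e _ => pauliX_pow_apply _ _ _
    rw [this, Fintype.prod_ite_zero]
    simp [funext_iff]
  change ∑ t : E → ZMod 2, tensorOp (fun e => pauliX ^ k e) s t * ψ t = _
  simp [h]

theorem tensorOp_pauliZ_mulVec {E : Type*} [Fintype E] [DecidableEq E] (k : E → ℕ)
    (ψ : (E → ZMod 2) → ℂ) (s : E → ZMod 2) :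
    Matrix.mulVec (tensorOp fun e => pauliZ ^ k e) ψ s
      = paritySign (∑ e, s e * (k e : ZMod 2)) * ψ s := by
  classical
  have h : ∀ t : E → ZMod 2, tensorOp (fun e => pauliZ ^ k e) s t
      = if t = s then paritySign (∑ e, s e * (k e : ZMod 2)) else 0 := by
    intro t
    have : tensorOp (fun e => pauliZ ^ k e) s t
        = ∏ e, if t e = s e then paritySign (s e * (k e : ZMod 2)) else 0 :=
      Finset.prod_congr rfl fun e _ => pauliZ_pow_apply _ _ _
    rw [this, Fintype.prod_ite_zero, paritySign_sum]
    simp [funext_iff]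
  change ∑ t : E → ZMod 2, tensorOp (fun e => pauliZ ^ k e) s t * ψ t = _
  simp [h]

/-! ### Ground states of the toric code -/

namespace SurfaceLattice

variable {Φ : Type*} [Finite Φ] (L : SurfaceLattice Φ)

theorem starOp_mulVec (v : L.Vertex) (ψ : (L.Edge → ZMod 2) → ℂ) (s : L.Edge → ZMod 2) :
    Matrix.mulVec (L.starOp v) ψ s = ψ (s + fun e => (L.legs v e : ZMod 2)) :=
  tensorOp_pauliX_mulVec _ ψ s

theorem plaquetteOp_mulVec (p : L.Face) (ψ : (L.Edge → ZMod 2) → ℂ) (s : L.Edge → ZMod 2) :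
    Matrix.mulVec (L.plaquetteOp p) ψ s = paritySign (L.faceParity s p) * ψ s :=
  tensorOp_pauliZ_mulVec _ ψ s

theorem hamiltonian_mulVec (U J : ℝ) (ψ : (L.Edge → ZMod 2) → ℂ) (s : L.Edge → ZMod 2) :
    Matrix.mulVec (L.hamiltonian U J) ψ s
      = -(U * ∑ v, ψ (s + fun e => (L.legs v e : ZMod 2)))
        - J * ∑ p, paritySign (L.faceParity s p) * ψ s := by
  have h : ∀ (ψ : (L.Edge → Fin 2) → ℂ) s, Matrix.mulVec (L.hamiltonian U J) ψ s
      = -(U * ∑ v, Matrix.mulVec (L.starOp v) ψ s)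
        - J * ∑ p, Matrix.mulVec (L.plaquetteOp p) ψ s := by
    intro ψ s
    rw [hamiltonian, Matrix.sub_mulVec, Matrix.neg_mulVec, Matrix.smul_mulVec,
      Matrix.smul_mulVec, Matrix.sum_mulVec, Matrix.sum_mulVec]
    simp only [Pi.sub_apply, Pi.neg_apply, Pi.smul_apply, Finset.sum_apply, smul_eq_mul]
  refine (h ψ s).trans ?_
  rw [Finset.sum_congr rfl fun v _ => L.starOp_mulVec v ψ s,
    Finset.sum_congr rfl fun p _ => L.plaquetteOp_mulVec p ψ s]

/-- A stabilized state is fixed by all star and plaquette operators. The former condition is stated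
for products of star operators, the latter in terms of the support of the state. -/
structure IsStabilized (ψ : (L.Edge → ZMod 2) → ℂ) : Prop where
  star_invariant : ∀ h s, ψ (s + L.starSum h) = ψ s
  plaquette_support : ∀ s, ψ s ≠ 0 → L.faceParity s = 0

/-- The uniform superposition of the configurations flipped by products of star operators is
stabilized. -/
theorem exists_isStabilized : ∃ ψ, ψ ≠ 0 ∧ L.IsStabilized ψ := by
  classical
  refine ⟨fun s => if s ∈ LinearMap.range L.starSum then 1 else 0, fun h => ?_, ⟨?_, ?_⟩⟩
  · have := congrFun h 0
    simp at this
  · intro h s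
    have : s + L.starSum h ∈ LinearMap.range L.starSum ↔ s ∈ LinearMap.range L.starSum :=
      Submodule.add_mem_iff_left _ ⟨h, rfl⟩
    simp only [this]
  · intro s hs
    by_cases h : s ∈ LinearMap.range L.starSum
    · obtain ⟨h, rfl⟩ := h
      exact L.faceParity_starSum h
    · exact absurd (if_neg h) hs

theorem starSum_single [DecidableEq L.Vertex] (v : L.Vertex) :
    L.starSum (Pi.single v 1) = fun e => (L.legs v e : ZMod 2) := by
  ext e
  simp [starSum_apply, Pi.single_apply]

variable {L}

theorem IsStabilized.hamiltonian_mulVec {ψ : (L.Edge → ZMod 2) → ℂ} (hψ : L.IsStabilized ψ)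
    (U J : ℝ) : Matrix.mulVec (L.hamiltonian U J) ψ
      = ((-(U * Fintype.card L.Vertex + J * Fintype.card L.Face) : ℝ) : ℂ) • ψ := by
  classical
  refine funext fun s : L.Edge → ZMod 2 => (L.hamiltonian_mulVec U J ψ s).trans ?_
  change _ = ((-(U * Fintype.card L.Vertex + J * Fintype.card L.Face) : ℝ) : ℂ) * ψ s
  simp_rw [← starSum_single, hψ.star_invariant]
  have : ∀ p, paritySign (L.faceParity s p) * ψ s = ψ s := by
    intro p
    by_cases hs : ψ s = 0
    · rw [hs, mul_zero]
    · simp [hψ.plaquette_support s hs, paritySign]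
  simp_rw [this]
  simp
  ring

theorem re_star_mul_eq (a b : ℂ) :
    (star a * b).re = (‖a‖ ^ 2 + ‖b‖ ^ 2 - ‖b - a‖ ^ 2) / 2 := by
  simp only [← Complex.normSq_eq_norm_sq, Complex.normSq_apply]
  simp
  ring

/-- The ground states are the states fixed by all star and plaquette operators: since some state is
fixed by all of them, each of these commuting reflections contributes its least possible energy. -/
theorem IsStabilized.of_isGroundState {U J : ℝ} (hU : 0 < U) (hJ : 0 < J)
    {ψ : (L.Edge → ZMod 2) → ℂ} (hψ : IsGroundState (L.hamiltonian U J) ψ) : L.IsStabilized ψ := by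
  classical
  obtain ⟨hnorm, E₀, hE, -, hleast⟩ := hψ
  change ∑ s : L.Edge → ZMod 2, ‖ψ s‖ ^ 2 = 1 at hnorm
  have hE₀ : E₀ ≤ -(U * Fintype.card L.Vertex + J * Fintype.card L.Face) := by
    obtain ⟨φ, hφ, hstab⟩ := L.exists_isStabilized
    exact hleast ⟨φ, hφ, hstab.hamiltonian_mulVec U J⟩
  let a : L.Vertex → L.Edge → ZMod 2 := fun v e => (L.legs v e : ZMod 2)
  -- The energy exceeds the lower bound by `U / 2` times the sum of the `‖A_v ψ - ψ‖ ^ 2` plus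
  -- `J / 2` times the sum of the `‖B_p ψ - ψ‖ ^ 2`.
  have henergy : ∑ s : L.Edge → ZMod 2,
      (star (ψ s) * Matrix.mulVec (L.hamiltonian U J) ψ s).re = E₀ := by
    have h : ∀ s : L.Edge → ZMod 2,
        (star (ψ s) * Matrix.mulVec (L.hamiltonian U J) ψ s).re = E₀ * ‖ψ s‖ ^ 2 := by
      intro s
      have hs : Matrix.mulVec (L.hamiltonian U J) ψ s = E₀ * ψ s := congrFun hE s
      rw [hs, mul_left_comm, Complex.re_ofReal_mul, re_star_mul_eq, sub_self]
      simp
    rw [Finset.sum_congr rfl fun s _ => h s, ← Finset.mul_sum, hnorm, mul_one]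
  have hshift : ∀ v, ∑ s, ‖ψ (s + a v)‖ ^ 2 = 1 := fun v =>
    (Equiv.sum_comp (Equiv.addRight (a v)) fun s => ‖ψ s‖ ^ 2).trans hnorm
  have hsign : ∀ z, ‖paritySign z‖ = 1 := by
    intro z
    unfold paritySign
    split_ifs <;> simp
  have hterm : ∀ s : L.Edge → ZMod 2, (star (ψ s) * Matrix.mulVec (L.hamiltonian U J) ψ s).re
      = -(U * ∑ v, (‖ψ s‖ ^ 2 + ‖ψ (s + a v)‖ ^ 2 - ‖ψ (s + a v) - ψ s‖ ^ 2) / 2)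
        - J * ∑ p, (‖ψ s‖ ^ 2 + ‖ψ s‖ ^ 2
          - ‖paritySign (L.faceParity s p) * ψ s - ψ s‖ ^ 2) / 2 := by
    intro s
    rw [L.hamiltonian_mulVec, mul_sub, mul_neg, Complex.sub_re, Complex.neg_re,
      mul_left_comm, mul_left_comm (star (ψ s)) (J : ℂ), Complex.re_ofReal_mul,
      Complex.re_ofReal_mul, Finset.mul_sum, Finset.mul_sum, Complex.re_sum, Complex.re_sum]
    simp_rw [re_star_mul_eq, norm_mul, hsign, one_mul]
    rfl
  have hstar : ∀ v, ∑ s, (‖ψ s‖ ^ 2 + ‖ψ (s + a v)‖ ^ 2 - ‖ψ (s + a v) - ψ s‖ ^ 2) / 2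
      = 1 - (∑ s, ‖ψ (s + a v) - ψ s‖ ^ 2) / 2 := by
    intro v
    rw [← Finset.sum_div, Finset.sum_sub_distrib, Finset.sum_add_distrib, hnorm, hshift]
    ring
  have hplaq : ∀ p, ∑ s, (‖ψ s‖ ^ 2 + ‖ψ s‖ ^ 2
        - ‖paritySign (L.faceParity s p) * ψ s - ψ s‖ ^ 2) / 2
      = 1 - (∑ s, ‖paritySign (L.faceParity s p) * ψ s - ψ s‖ ^ 2) / 2 := by
    intro p
    rw [← Finset.sum_div, Finset.sum_sub_distrib, Finset.sum_add_distrib, hnorm]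
    ring
  rw [Finset.sum_congr rfl fun s _ => hterm s, Finset.sum_sub_distrib, Finset.sum_neg_distrib,
    ← Finset.mul_sum, ← Finset.mul_sum, Finset.sum_comm,
    Finset.sum_comm (t := (Finset.univ : Finset L.Face)),
    Finset.sum_congr rfl fun v _ => hstar v, Finset.sum_congr rfl fun p _ => hplaq p,
    Finset.sum_sub_distrib, Finset.sum_sub_distrib, ← Finset.sum_div, ← Finset.sum_div] at henergy
  simp only [Finset.sum_const, Finset.card_univ, nsmul_eq_mul, mul_one] at henergy
  have hstar0 : 0 ≤ ∑ v, ∑ s, ‖ψ (s + a v) - ψ s‖ ^ 2 :=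
    Finset.sum_nonneg fun _ _ => Finset.sum_nonneg fun _ _ => by positivity
  have hplaq0 : 0 ≤ ∑ p, ∑ s, ‖paritySign (L.faceParity s p) * ψ s - ψ s‖ ^ 2 :=
    Finset.sum_nonneg fun _ _ => Finset.sum_nonneg fun _ _ => by positivity
  have hU0 := mul_nonneg hU.le hstar0
  have hJ0 := mul_nonneg hJ.le hplaq0
  have hstar1 : ∑ v, ∑ s, ‖ψ (s + a v) - ψ s‖ ^ 2 = 0 :=
    (mul_eq_zero.1 (by linarith : U * _ = 0)).resolve_left hU.ne'
  have hplaq1 : ∑ p, ∑ s, ‖paritySign (L.faceParity s p) * ψ s - ψ s‖ ^ 2 = 0 :=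
    (mul_eq_zero.1 (by linarith : J * _ = 0)).resolve_left hJ.ne'
  have hstar2 : ∀ v s, ψ (s + a v) = ψ s := by
    intro v s
    have h1 := (Finset.sum_eq_zero_iff_of_nonneg
      fun _ _ => Finset.sum_nonneg fun _ _ => by positivity).1 hstar1 v (Finset.mem_univ _)
    have h2 := (Finset.sum_eq_zero_iff_of_nonneg
      fun _ _ => by positivity).1 h1 s (Finset.mem_univ _)
    exact sub_eq_zero.1 (norm_eq_zero.1 (pow_eq_zero_iff two_ne_zero |>.1 h2))
  have hplaq2 : ∀ p s, paritySign (L.faceParity s p) * ψ s = ψ s := by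
    intro p s
    have h1 := (Finset.sum_eq_zero_iff_of_nonneg
      fun _ _ => Finset.sum_nonneg fun _ _ => by positivity).1 hplaq1 p (Finset.mem_univ _)
    have h2 := (Finset.sum_eq_zero_iff_of_nonneg
      fun _ _ => by positivity).1 h1 s (Finset.mem_univ _)
    exact sub_eq_zero.1 (norm_eq_zero.1 (pow_eq_zero_iff two_ne_zero |>.1 h2))
  constructor
  · intro h s
    have hh : L.starSum h = ∑ v, h v • a v := by
      ext e
      simp [starSum_apply, a]
    rw [hh]
    generalize (Finset.univ : Finset L.Vertex) = V
    induction V using Finset.induction_on generalizing s with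
    | empty => simp
    | insert v V hv ih =>
      rw [Finset.sum_insert hv, ← add_assoc, ih]
      rcases (by decide : ∀ c : ZMod 2, c = 0 ∨ c = 1) (h v) with h0 | h1
      · rw [h0, zero_smul, add_zero]
      · rw [h1, one_smul, hstar2]
  · intro s hs
    ext p
    by_contra hp
    change L.faceParity s p ≠ 0 at hp
    have h := hplaq2 p s
    rw [paritySign, if_neg hp, neg_one_mul, neg_eq_self] at h
    exact hs h

end SurfaceLattice

/-! ### The Schmidt spectrum of a ground state -/

namespace SurfaceLattice

variable {Φ : Type*} {L : SurfaceLattice Φ} {A : Set L.Edge}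

/-- The configuration with the given restrictions to `A` and to its complement, its bits being read
as residues modulo two so that configurations can be added. -/
noncomputable def mergedConfig (A : Set L.Edge) (a : A → Fin 2) (b : {e // e ∉ A} → Fin 2) :
    L.Edge → ZMod 2 :=
  mergeEquiv A (a, b)

theorem mergedConfig_of_mem (a : A → Fin 2) (b : {e // e ∉ A} → Fin 2) {e : L.Edge} (he : e ∈ A) :
    mergedConfig A a b e = a ⟨e, he⟩ :=
  (mergeEquiv_apply A a b e).trans (dif_pos he)

theorem mergedConfig_of_notMem (a : A → Fin 2) (b : {e // e ∉ A} → Fin 2) {e : L.Edge}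
    (he : e ∉ A) : mergedConfig A a b e = b ⟨e, he⟩ :=
  (mergeEquiv_apply A a b e).trans (dif_neg he)

/-- Adding the difference on `A` exchanges the parts on `A` of two configurations. -/
theorem mergedConfig_add_indicator (a a' : A → Fin 2) (b b' : {e // e ∉ A} → Fin 2) :
    mergedConfig A a' b' + A.indicator (mergedConfig A a b + mergedConfig A a' b')
      = mergedConfig A a b' := by
  classical
  have hchar : ∀ x y : ZMod 2, x + (y + x) = y := by decide
  funext e
  rw [Pi.add_apply]
  by_cases he : e ∈ A
  · rw [Set.indicator_of_mem he, Pi.add_apply, hchar]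
    rw [mergedConfig_of_mem a b he, mergedConfig_of_mem a b' he]
  · rw [Set.indicator_of_notMem he, add_zero]
    rw [mergedConfig_of_notMem a' b' he, mergedConfig_of_notMem a b' he]

variable [Finite Φ]

theorem config_add_self {E : Type*} (s : E → ZMod 2) : s + s = 0 :=
  funext fun _ => CharTwo.add_self_eq_zero _

open Classical in
/-- The probability that a measurement of the qubits of `A` in the product basis gives the
configuration `s` up to a cycle of `A`. -/
noncomputable def cycleWeight (A : Set L.Edge) (ψ : (L.Edge → ZMod 2) → ℂ)
    (s : L.Edge → ZMod 2) : ℝ :=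
  ∑ t, if A.indicator s + A.indicator t ∈ cycles A then ‖ψ t‖ ^ 2 else 0

/-- Invariance under the star operators makes the weights of all inner cycles equal. -/
theorem IsStabilized.cycleWeight_eq (hA : IsContractible A) {ψ : (L.Edge → ZMod 2) → ℂ}
    (hψ : L.IsStabilized ψ) {s : L.Edge → ZMod 2} (hs : A.indicator s ∈ innerCycles A) :
    cycleWeight A ψ s = cycleWeight A ψ 0 := by
  classical
  obtain ⟨h, hh⟩ := hA.exists_indicator_starSum_eq hs
  unfold cycleWeight
  -- The star operators which produce `s` on `A` carry the weight at `0` to the weight at `s`.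
  rw [← Equiv.sum_comp (Equiv.addRight (L.starSum h))]
  refine Finset.sum_congr rfl fun t _ => ?_
  rw [Equiv.coe_addRight, hψ.star_invariant, Set.indicator_add' A t, hh, Set.indicator_zero',
    zero_add, add_left_comm, config_add_self, add_zero]

/-- The inner cycles carry the whole weight of a stabilized state, and each configuration
contributes to the weights of exactly as many inner cycles as there are cycles in `A`. -/
theorem IsStabilized.sum_cycleWeight {ψ : (L.Edge → ZMod 2) → ℂ}
    (hψ : L.IsStabilized ψ) (hnorm : ∑ s, ‖ψ s‖ ^ 2 = 1) [Fintype (innerCycles A)]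
    [Fintype (cycles A)] :
    ∑ w : innerCycles A, cycleWeight A ψ w.1 = Fintype.card (cycles A) := by
  classical
  have hw : ∀ w : innerCycles A, A.indicator w.1 = w.1 := fun w =>
    Set.indicator_eq_self.2 fun e he => by
      by_contra h
      exact he (w.2.1 e h)
  unfold cycleWeight
  rw [Finset.sum_comm, ← mul_one (Fintype.card (cycles A) : ℝ), ← hnorm, Finset.mul_sum]
  refine Finset.sum_congr rfl fun t _ => ?_
  by_cases ht : ψ t = 0
  · simp [ht]
  have htA := indicator_mem_innerCycles (A := A) (hψ.plaquette_support t ht)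
  rw [← Finset.sum_filter, Finset.sum_const, nsmul_eq_mul]
  congr 2
  rw [← Fintype.card_subtype]
  -- The inner cycles to which `t` contributes form the coset of the cycles through `t` on `A`.
  refine Fintype.card_congr
    { toFun := fun w => ⟨_, w.2⟩
      invFun := fun z => ⟨⟨z.1 + A.indicator t,
        add_mem (cycles_le_innerCycles A z.2) htA⟩, ?_⟩
      left_inv := fun w => ?_
      right_inv := fun z => ?_ }
  · rw [hw, add_assoc, config_add_self, add_zero]
    exact z.2
  · refine Subtype.ext (Subtype.ext ?_)
    change A.indicator w.1.1 + _ + _ = w.1.1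
    rw [hw, add_assoc, config_add_self, add_zero]
  · refine Subtype.ext ?_
    have := hw ⟨z.1 + A.indicator t, add_mem (cycles_le_innerCycles A z.2) htA⟩
    change A.indicator (z.1 + A.indicator t) + _ = z.1
    rw [this, add_assoc, config_add_self, add_zero]

/-- The common weight of the inner cycles is the ratio of the numbers of cycles and of inner
cycles. -/
theorem IsStabilized.cycleWeight_zero (hA : IsContractible A)
    (hint : ∀ x, L.edge x ∈ A → L.faceFlip x ≠ x) (hne : A.Nonempty) (hB : Aᶜ.Nonempty)
    {ψ : (L.Edge → ZMod 2) → ℂ} (hψ : L.IsStabilized ψ) (hnorm : ∑ s, ‖ψ s‖ ^ 2 = 1) :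
    cycleWeight A ψ 0 = 2 / 2 ^ numStraddling A := by
  classical
  have := Fintype.ofFinite (innerCycles A)
  have := Fintype.ofFinite (cycles A)
  have h := hψ.sum_cycleWeight hnorm (A := A)
  have hw : ∀ w : innerCycles A, cycleWeight A ψ w.1 = cycleWeight A ψ 0 := fun w =>
    hψ.cycleWeight_eq hA (by
      rw [Set.indicator_eq_self.2 fun e he => by
        by_contra h
        exact he (w.2.1 e h)]
      exact w.2)
  rw [Finset.sum_congr rfl fun w _ => hw w, Finset.sum_const, Finset.card_univ, nsmul_eq_mul,
    Module.card_eq_pow_finrank (K := ZMod 2) (V := innerCycles A),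
    Module.card_eq_pow_finrank (K := ZMod 2) (V := cycles A), ZMod.card] at h
  have hrank := hA.finrank_innerCycles hint hne hB
  have hpow : (2 : ℝ) ^ Module.finrank (ZMod 2) (innerCycles A) * 2
      = 2 ^ Module.finrank (ZMod 2) (cycles A) * 2 ^ numStraddling A := by
    rw [← pow_succ, hrank, pow_add]
  push_cast at h
  rw [eq_div_iff (by positivity)]
  have h2 : (2 : ℝ) ^ Module.finrank (ZMod 2) (innerCycles A) ≠ 0 := by positivity
  apply mul_left_cancel₀ h2
  rw [hpow, ← mul_assoc, h]

/-- If two configurations of nonzero amplitude still have it after the exchange of their parts on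
`A`, they differ on `A` by a cycle, hence by a product of star operators, which preserves the
amplitudes. The left side is an entry of `M Mᴴ M` for the matrix `M` of amplitudes. -/
theorem IsStabilized.sum_exchange (hA : IsContractible A)
    (hint : ∀ x, L.edge x ∈ A → L.faceFlip x ≠ x)
    {ψ : (L.Edge → ZMod 2) → ℂ} (hψ : L.IsStabilized ψ) (s : L.Edge → ZMod 2) :
    ∑ t, ψ (t + A.indicator (s + t)) * star (ψ t) * ψ (s + A.indicator (s + t))
      = (cycleWeight A ψ 0 : ℂ) * ψ s := by
  classical
  have hterm : ∀ t, ψ (t + A.indicator (s + t)) * star (ψ t) * ψ (s + A.indicator (s + t))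
      = ((if A.indicator s + A.indicator t ∈ cycles A then ‖ψ t‖ ^ 2 else 0 : ℝ) : ℂ) * ψ s := by
    intro t
    rw [← Set.indicator_add']
    have hsupp : ∀ e ∉ A, A.indicator (s + t) e = 0 := fun e he => Set.indicator_of_notMem he _
    split_ifs with hu
    · obtain ⟨h, hh⟩ := hA.mem_range_starSum hint _ hsupp hu.2
      rw [← hh, hψ.star_invariant, hψ.star_invariant, Complex.ofReal_pow]
      congr 1
      exact Complex.mul_conj' (ψ t)
    · rw [Complex.ofReal_zero, zero_mul]
      by_contra hne
      have h1 : ψ t ≠ 0 := by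
        rintro h
        simp [h] at hne
      have h2 : ψ (t + A.indicator (s + t)) ≠ 0 := by
        rintro h
        simp [h] at hne
      have h3 := hψ.plaquette_support _ h2
      rw [map_add, hψ.plaquette_support _ h1, zero_add] at h3
      exact hu ⟨hsupp, h3⟩
  rw [Finset.sum_congr rfl fun t _ => hterm t, ← Finset.sum_mul, ← Complex.ofReal_sum]
  change (cycleWeight A ψ s : ℂ) * ψ s = _
  by_cases hs : ψ s = 0
  · rw [hs, mul_zero, mul_zero]
  · rw [hψ.cycleWeight_eq hA (indicator_mem_innerCycles (hψ.plaquette_support s hs))]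

open Classical in
theorem amplitudes_mul_mul_apply (ψ : (L.Edge → ZMod 2) → ℂ)
    (a : A → Fin 2) (b : {e // e ∉ A} → Fin 2) :
    (amplitudes A ψ * (amplitudes A ψ).conjTranspose * amplitudes A ψ) a b
      = ∑ t, ψ (t + A.indicator (mergedConfig A a b + t)) * star (ψ t)
          * ψ (mergedConfig A a b + A.indicator (mergedConfig A a b + t)) := by
  have hsum : ∀ F : (L.Edge → ZMod 2) → ℂ,
      ∑ t, F t = ∑ a' : A → Fin 2, ∑ b' : {e // e ∉ A} → Fin 2, F (mergedConfig A a' b') :=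
    fun F => ((mergeEquiv A).sum_comp F).symm.trans (Fintype.sum_prod_type _)
  rw [hsum, Matrix.mul_apply, Finset.sum_comm]
  simp_rw [Matrix.mul_apply, Finset.sum_mul]
  rw [Finset.sum_comm]
  refine Finset.sum_congr rfl fun b' _ => Finset.sum_congr rfl fun a' _ => ?_
  rw [mergedConfig_add_indicator, add_comm (mergedConfig A a b) (mergedConfig A a' b'),
    mergedConfig_add_indicator]
  rfl

end SurfaceLattice

theorem mainTheorem2 {Φ : Type*} [Finite Φ] (L : SurfaceLattice Φ) (A : Set L.Edge)
    (hA : SurfaceLattice.IsContractible A) (hne : A.Nonempty) (hB : Aᶜ.Nonempty)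
    (hint : ∀ x, L.edge x ∈ A → L.faceFlip x ≠ x)
    (U J : ℝ) (hU : 0 < U) (hJ : 0 < J)
    (ψ : (L.Edge → Fin 2) → ℂ) (hψ : IsGroundState (L.hamiltonian U J) ψ) :
    logNegativity A (pureState ψ) = (SurfaceLattice.numStraddling A : ℝ) - 1 ∧
      renyiHalf (reducedState A (pureState ψ)) =
        (SurfaceLattice.numStraddling A : ℝ) - 1 := by
  classical
  have hstab : L.IsStabilized ψ := .of_isGroundState hU hJ hψ
  have hnorm : ∑ s : L.Edge → ZMod 2, ‖ψ s‖ ^ 2 = 1 := hψ.1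
  have hweight := hstab.cycleWeight_zero hA hint hne hB hnorm
  have hlog : Real.logb 2 (2 / 2 ^ SurfaceLattice.numStraddling A : ℝ)⁻¹
      = (SurfaceLattice.numStraddling A : ℝ) - 1 := by
    rw [inv_div, Real.logb_div (by positivity) two_ne_zero, Real.logb_pow,
      Real.logb_self_eq_one one_lt_two, mul_one]
  rw [← hlog]
  refine entanglement_of_flat_spectrum A hψ.1 (by positivity) ?_
  ext a b
  rw [← hweight, Matrix.smul_apply, smul_eq_mul]
  exact (SurfaceLattice.amplitudes_mul_mul_apply ψ a b).trans (hstab.sum_exchange hA hint _)
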